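/- A \emph{map} is a finite connected multigraph (loops and parallel edges allowed) together with, for each vertex, a cyclic order (counterclockwise) of the directed edges starting there. Write $\theta$ for the inversion of directed edges and $\sigma$ for the permutation sending a directed edge to the next one around its start. The \emph{faces} are the orbits of $\theta\sigma$, and the size of a face is the number of directed edges in it. The map is \emph{plane} if $|V|-|E|+|F|=2$, and it is a \emph{quadrangulation} if every face has size $4$. Consider the following three extensions of a map, each of which adds one vertex $w$ and two edges. \begin{itemize} \item $D_1$: for an edge $e$ with two distinct endpoints $x,y$, double $e$ so that the two copies bound a disc, and inside this disc add a new vertex $w$ of degree $1$ joined to $x$. \item $P_0$: for two edges $xa$, $xb$ that are consecutive in the cyclic order around $x$, with $x,a,b$ distinct, place a new vertex $w$ of degree $2$ in the face at the angle between them and join it to $a$ and $b$, so that $x,a,w,b$ bound a face. \item $P_1$: for three edges $xa$, $xc$, $xb$ that are consecutive in this order around $x$, with $x,a,c,b$ distinct, split off from $x$ a new vertex $w$ of degree $3$: the edge $xc$ is replaced by $wc$, new edges $wa$ and $wb$ are added (next to $xa$ around $a$ and next to $xb$ around $b$, respectively), the cyclic order around $w$ is $wa, wc, wb$, and $x,a,w,b$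 bound a face. \end{itemize} \textbf{Theorem.} Every plane quadrangulation, parallel edges allowed, can be obtained (up to isomorphism) from the path graph with $3$ vertices by applying the extensions $D_1$, $P_0$ and $P_1$ finitely many times (possibly zero times). -/

import Mathlib

universe u v

/-- A map (graph embedded in an oriented closed surface with open discs as faces), in its
combinatorial form: a connected multigraph with vertex type `V` and type `D` of directed edges,
together with a rotation that imposes a cyclic order on the directed edges starting in each
vertex. Loops and parallel edges are allowed. -/
structure OrientedMap (V : Type u) (D : Type v) where
  /-- the vertex in which a directed edge starts -/
  start : D → V
  /-- the inverse of a directed edge -/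
  rev : Equiv.Perm D
  /-- the next directed edge in the cyclic order around the common start -/
  rot : Equiv.Perm D
  rev_rev : ∀ d, rev (rev d) = d
  rev_ne : ∀ d, rev d ≠ d
  start_rot : ∀ d, start (rot d) = start d
  sameCycle_rot : ∀ d e, start d = start e → rot.SameCycle d e
  nonempty : Nonempty V
  connected : ∀ x y : V,
    Relation.ReflTransGen (fun s t => ∃ d, start d = s ∧ start (rev d) = t) x y

namespace OrientedMap

variable {V : Type u} {D : Type v} {V' : Type u} {D' : Type v}

/-- The vertex in which a directed edge ends. -/
def target (M : OrientedMap V D) (d : D) : V := M.start (M.rev d)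

/-- The (undirected) edges: the orbits of directed edges under inversion. -/
def Edge (M : OrientedMap V D) : Type v :=
  Quotient (Equiv.Perm.SameCycle.setoid M.rev)

/-- The faces: the orbits of directed edges under `rev ∘ rot`. -/
def Face (M : OrientedMap V D) : Type v :=
  Quotient (Equiv.Perm.SameCycle.setoid (M.rev * M.rot))

/-- The face that contains a given directed edge. -/
def faceOf (M : OrientedMap V D) (d : D) : M.Face :=
  Quotient.mk (Equiv.Perm.SameCycle.setoid (M.rev * M.rot)) d

/-- The size of a face: the number of directed edges in it. -/
noncomputable def faceSize (M : OrientedMap V D) (F : M.Face) : ℕ :=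
  Nat.card {d : D // M.faceOf d = F}

/-- The genus, `(2 - |V| + |E| - |F|) / 2`. -/
noncomputable def genus (M : OrientedMap V D) : ℚ :=
  (2 - (Nat.card V : ℚ) + (Nat.card M.Edge : ℚ) - (Nat.card M.Face : ℚ)) / 2

/-- A map is plane if its genus is 0. -/
def IsPlane (M : OrientedMap V D) : Prop := M.genus = 0

/-- A map is a quadrangulation if every face has size 4. -/
def IsQuadrangulation (M : OrientedMap V D) : Prop := ∀ F : M.Face, M.faceSize F = 4

/-- The path graph with 3 vertices: the edges of `d` and `e` are its only two edges, they share
the middle vertex, in which both `d` and `e` start. -/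
def IsPath3 (M : OrientedMap V D) : Prop :=
  ∃ d e : D, M.start d = M.start e ∧
    [M.target d, M.start d, M.target e].Nodup ∧
    (∀ x : V, x ∈ [M.target d, M.start d, M.target e]) ∧
    (∀ z : D, z ∈ [d, M.rev d, e, M.rev e])

/-- `M'` has the vertices of `M` (via `f`) and one more vertex `w`, and the edges of `M` (via `g`)
and two more edges, with directed edges `m`, `rev m` and `n`, `rev n`. -/
structure AddsVertexAndTwoEdges (M : OrientedMap V D) (M' : OrientedMap V' D')
    (f : V ↪ V') (g : D ↪ D') (w : V') (m n : D') : Prop where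
  compl_range_vertex : (Set.range f)ᶜ = {w}
  compl_range_dart : (Set.range g)ᶜ = {m, M'.rev m, n, M'.rev n}
  nodup : [m, M'.rev m, n, M'.rev n].Nodup
  rev_old : ∀ z, M'.rev (g z) = g (M.rev z)

/-- `M'` arises from `M` by the extension `D₁`: an edge between two distinct vertices `x` and `y`
is doubled (so that the two copies bound a disc), and inside that disc a new vertex `w` of
degree 1 is joined to `x`. Here `d` goes from `x` to `y`, the new directed edges are `m` from `x`
to `w` and `n` from `x` to `y`, and the order around `x` becomes `…, d, m, n, …`. -/
def ExtD1 (M : OrientedMap V D) (M' : OrientedMap V' D') : Prop :=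
  ∃ (f : V ↪ V') (g : D ↪ D') (w : V') (m n : D') (d : D),
    AddsVertexAndTwoEdges M M' f g w m n ∧
    M.start d ≠ M.target d ∧
    -- endpoints
    (∀ z, M'.start (g z) = f (M.start z)) ∧
    M'.start m = f (M.start d) ∧ M'.target m = w ∧
    M'.start n = f (M.start d) ∧ M'.target n = f (M.target d) ∧
    -- around the new vertex
    M'.rot (M'.rev m) = M'.rev m ∧
    -- around `x`
    M'.rot (g d) = m ∧ M'.rot m = n ∧ M'.rot n = g (M.rot d) ∧
    -- around `y`: `rev n` is inserted just before `rev d`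
    (∀ z, M.rot z = M.rev d → M'.rot (g z) = M'.rev n) ∧ M'.rot (M'.rev n) = g (M.rev d) ∧
    -- everywhere else nothing changes
    (∀ z, z ≠ d → M.rot z ≠ M.rev d → M'.rot (g z) = g (M.rot z))

/-- `M'` arises from `M` by the extension `P₀`: for two directed edges `p` and `r` that are
consecutive around a vertex `x` and end in `a` and `b` (`x`, `a`, `b` distinct), a new vertex `w`
of degree 2, adjacent to `a` and `b`, is placed in the face at the angle between `p` and `r`, so
that `x, a, w, b` bound a new face. The new directed edges are `m` from `w` to `a` and `n` from `w`
to `b`. -/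
def ExtP0 (M : OrientedMap V D) (M' : OrientedMap V' D') : Prop :=
  ∃ (f : V ↪ V') (g : D ↪ D') (w : V') (m n : D') (p r : D),
    AddsVertexAndTwoEdges M M' f g w m n ∧
    M.rot p = r ∧
    [M.start p, M.target p, M.target r].Nodup ∧
    -- endpoints
    (∀ z, M'.start (g z) = f (M.start z)) ∧
    M'.start m = w ∧ M'.target m = f (M.target p) ∧
    M'.start n = w ∧ M'.target n = f (M.target r) ∧
    -- around the new vertex
    M'.rot m = n ∧ M'.rot n = m ∧
    -- around `a`: `rev m` is inserted just before `rev p`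
    (∀ z, M.rot z = M.rev p → M'.rot (g z) = M'.rev m) ∧ M'.rot (M'.rev m) = g (M.rev p) ∧
    -- around `b`: `rev n` is inserted just after `rev r`
    M'.rot (g (M.rev r)) = M'.rev n ∧ M'.rot (M'.rev n) = g (M.rot (M.rev r)) ∧
    -- everywhere else nothing changes
    (∀ z, z ≠ M.rev r → M.rot z ≠ M.rev p → M'.rot (g z) = g (M.rot z))

/-- `M'` arises from `M` by the extension `P₁`: for three directed edges `p`, `q`, `r` that are
consecutive around a vertex `x` and end in `a`, `c`, `b` (`x`, `a`, `c`, `b` distinct), a new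
vertex `w` of degree 3, adjacent to `a`, `c` and `b`, is split off from `x`: the edge of `q` now
joins `c` to `w` instead of `x`, there are new edges from `w` to `a` and `b`, and `x, a, w, b`
bound a new face. The new directed edges are `m` from `w` to `a` and `n` from `w` to `b`. -/
def ExtP1 (M : OrientedMap V D) (M' : OrientedMap V' D') : Prop :=
  ∃ (f : V ↪ V') (g : D ↪ D') (w : V') (m n : D') (p q r : D),
    AddsVertexAndTwoEdges M M' f g w m n ∧
    M.rot p = q ∧ M.rot q = r ∧
    [M.start p, M.target p, M.target q, M.target r].Nodup ∧
    -- endpoints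
    (∀ z, z ≠ q → M'.start (g z) = f (M.start z)) ∧ M'.start (g q) = w ∧
    M'.start m = w ∧ M'.target m = f (M.target p) ∧
    M'.start n = w ∧ M'.target n = f (M.target r) ∧
    -- around the new vertex
    M'.rot m = g q ∧ M'.rot (g q) = n ∧ M'.rot n = m ∧
    -- around `x`: `q` is removed
    M'.rot (g p) = g r ∧
    -- around `a`: `rev m` is inserted just before `rev p`
    (∀ z, M.rot z = M.rev p → M'.rot (g z) = M'.rev m) ∧ M'.rot (M'.rev m) = g (M.rev p) ∧
    -- around `b`: `rev n` is inserted just after `rev r`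
    M'.rot (g (M.rev r)) = M'.rev n ∧ M'.rot (M'.rev n) = g (M.rot (M.rev r)) ∧
    -- everywhere else nothing changes
    (∀ z, z ≠ p → z ≠ q → z ≠ M.rev r → M.rot z ≠ M.rev p → M'.rot (g z) = g (M.rot z))

/-- The maps that can be obtained from the path graph with 3 vertices by repeatedly applying the
extensions `D₁`, `P₀` and `P₁`. -/
inductive Generated : ∀ {V : Type u} {D : Type v}, OrientedMap V D → Prop
  | base {V : Type u} {D : Type v} (M : OrientedMap V D) : M.IsPath3 → Generated M
  | extD1 {V V' : Type u} {D D' : Type v} (M : OrientedMap V D) (M' : OrientedMap V' D') :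
      Generated M → ExtD1 M M' → Generated M'
  | extP0 {V V' : Type u} {D D' : Type v} (M : OrientedMap V D) (M' : OrientedMap V' D') :
      Generated M → ExtP0 M M' → Generated M'
  | extP1 {V V' : Type u} {D D' : Type v} (M : OrientedMap V D) (M' : OrientedMap V' D') :
      Generated M → ExtP1 M M' → Generated M'

end OrientedMap

/-! The proof is an induction on the number of directed edges that undoes one extension at a time.
The main point is that a plane quadrangulation has a vertex $w$ of degree at most 3 at which no two
edges are parallel (`IsPlaneQuadPair.exists_isReducible`).

Given such a $w$ of degree 2 or 3, take a face $w,a,x,b$ at $w$. If $x=w$, the map is the path with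
3 vertices. Otherwise fold the face: merge $w$ into $x$, the edge $wa$ into $xa$ and $wb$ into $xb$.
This undoes $P_0$ or $P_1$. If $w$ has degree 1, its face is $w,a,x,a$; either the map is the path,
or removing $w$ and closing the digon between the two edges $xa$ undoes $D_1$. Folding destroys one
face and changes the face permutation on the rest only by conjugation, so the result is again a
quadrangulation. It is plane because for quadrangulations this means $4|V|=|D|+8$, where $D$ is the
set of directed edges.

To find $w$, one proves more: $w$ can avoid both ends of a prescribed edge $e$. Without parallel
edges, Euler's formula says that $1/\deg-1/4$, summed over the directed edges, is 2. Each end of $e$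
contributes less than 1, so some other vertex contributes a positive amount and has degree at most
3. If there are parallel edges $d_1,d_2$, cut along the digon and close each side to a single edge.
By planarity the two sides are distinct components; induction, applied to the side without $e$ and
avoiding the new edge, gives a vertex that the cut has not touched.

All of this is done with pairs of permutations $\alpha$ (inversion) and $\varphi$ (faces), with the
vertices as cycles of $\alpha\varphi$ and no connectedness required. Planarity is equality in the
genus inequality `excess_le`; the role of the Jordan curve theorem is played by
`numClasses_cutInversion`. -/

open Equiv Equiv.Perm

/-! ### Equivalence relations and their numbers of classes -/

section Setoid

variable {X : Type*}

/-- The number of classes of an equivalence relation. -/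
noncomputable def Setoid.numClasses (r : Setoid X) : ℕ := Nat.card (Quotient r)

/-- The equivalence relation that arises from `r` by uniting the classes of `i` and `j`. -/
def Setoid.adjoin (r : Setoid X) (i j : X) : Setoid X where
  r x y := r x y ∨ ((r x i ∨ r x j) ∧ (r y i ∨ r y j))
  iseqv := by
    refine ⟨fun x => Or.inl (r.refl' x), ?_, ?_⟩
    · rintro x y (h | ⟨h, h'⟩)
      · exact Or.inl (r.symm' h)
      · exact Or.inr ⟨h', h⟩
    · rintro x y z (h | ⟨h, h'⟩) (k | ⟨k, k'⟩)
      · exact Or.inl (r.trans' h k)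
      · exact Or.inr ⟨k.imp (r.trans' h) (r.trans' h), k'⟩
      · exact Or.inr ⟨h, h'.imp (r.trans' (r.symm' k)) (r.trans' (r.symm' k))⟩
      · exact Or.inr ⟨h, k'⟩

namespace Setoid

theorem le_adjoin (r : Setoid X) (i j : X) : r ≤ r.adjoin i j := fun _ _ h => Or.inl h

theorem adjoin_rel (r : Setoid X) (i j : X) : r.adjoin i j i j :=
  Or.inr ⟨Or.inl (r.refl' i), Or.inr (r.refl' j)⟩

theorem adjoin_le {r t : Setoid X} {i j : X} (h : r ≤ t) (hij : t i j) : r.adjoin i j ≤ t := by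
  rintro x y (k | ⟨k, k'⟩)
  · exact h k
  · have hx : t x i := k.elim (fun k => h k) fun k => t.trans' (h k) (t.symm' hij)
    have hy : t y i := k'.elim (fun k => h k) fun k => t.trans' (h k) (t.symm' hij)
    exact t.trans' hx (t.symm' hy)

theorem adjoin_eq_self {r : Setoid X} {i j : X} (h : r i j) : r.adjoin i j = r :=
  le_antisymm (adjoin_le le_rfl h) (le_adjoin r i j)

theorem adjoin_sup (r s : Setoid X) (i j : X) : r.adjoin i j ⊔ s = (r ⊔ s).adjoin i j := by
  apply le_antisymm
  · refine sup_le (adjoin_le (le_sup_left.trans (le_adjoin _ i j)) (adjoin_rel _ i j)) ?_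
    exact le_sup_right.trans (le_adjoin _ i j)
  · refine adjoin_le (sup_le_sup_right (le_adjoin r i j) s) ?_
    exact (le_sup_left : r.adjoin i j ≤ r.adjoin i j ⊔ s) (adjoin_rel r i j)

theorem numClasses_adjoin [Finite X] {r : Setoid X} {i j : X} (h : ¬ r i j) :
    r.numClasses = (r.adjoin i j).numClasses + 1 := by
  classical
  -- The class of `j` can be left out, since the class of `i` represents the united class.
  let F : {q : Quotient r // q ≠ Quotient.mk r j} → Quotient (r.adjoin i j) := fun q =>
    Quotient.map' id (fun _ _ k => le_adjoin r i j k) q.1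
  have hF : Function.Bijective F := by
    constructor
    · rintro ⟨a, ha⟩ ⟨b, hb⟩ hab
      induction a using Quotient.inductionOn with | _ a
      induction b using Quotient.inductionOn with | _ b
      have ha' : ¬ r a j := fun k => ha (Quotient.sound k)
      have hb' : ¬ r b j := fun k => hb (Quotient.sound k)
      have key : r.adjoin i j a b := Quotient.exact hab
      apply Subtype.ext
      apply Quotient.sound
      rcases key with k | ⟨k | k, k' | k'⟩
      · exact k
      · exact r.trans' k (r.symm' k')
      · exact absurd k' hb'
      · exact absurd k ha'
      · exact absurd k ha'
    · intro q
      induction q using Quotient.inductionOn with | _ a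
      by_cases ha : r a j
      · refine ⟨⟨Quotient.mk r i, fun k => h (Quotient.exact k)⟩, ?_⟩
        exact Quotient.sound (s := r.adjoin i j) (Or.inr ⟨Or.inl (r.refl' i), Or.inr ha⟩)
      · exact ⟨⟨Quotient.mk r a, fun k => ha (Quotient.exact k)⟩, rfl⟩
  rw [numClasses, numClasses, ← Nat.card_congr (Equiv.ofBijective F hF), ← Finite.card_option]
  exact (Nat.card_congr (Equiv.optionSubtypeNe (Quotient.mk r j))).symm

theorem numClasses_le_adjoin_add_one [Finite X] (r : Setoid X) (i j : X) :
    r.numClasses ≤ (r.adjoin i j).numClasses + 1 := by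
  by_cases h : r i j
  · rw [adjoin_eq_self h]; omega
  · exact (numClasses_adjoin h).le

theorem numClasses_le_of_le [Finite X] {r s : Setoid X} (h : r ≤ s) :
    s.numClasses ≤ r.numClasses := by
  refine Nat.card_le_card_of_surjective (Quotient.map' id fun _ _ k => h k) ?_
  intro q
  induction q using Quotient.inductionOn with | _ a
  exact ⟨Quotient.mk r a, rfl⟩

end Setoid

end Setoid

/-! ### Cycle counts under transpositions, and the genus inequality -/

namespace Equiv.Perm

variable {X : Type*} {f g : Perm X} {x y i j : X}

theorem setoid_apply_self (f : Perm X) (x : X) : SameCycle.setoid f x (f x) := ⟨1, by simp⟩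

/-- The product fixes `i` as well as all fixed points of `f`. This is the measure for inductions
that dismantle `f` one transposition at a time. -/
theorem support_swap_apply_mul_ssubset [DecidableEq X] (f : Perm X) (i : X) (hi : f i ≠ i) :
    {x | (swap i (f i) * f) x ≠ x} ⊂ {x | f x ≠ x} := by
  rw [Set.ssubset_iff_of_subset]
  · exact ⟨i, hi, by simp⟩
  · intro x hx hfx
    apply hx
    rw [mul_apply, hfx]
    apply swap_apply_of_ne_of_ne
    · rintro rfl; exact hi hfx
    · rintro rfl; exact hi (f.injective hfx)

/-- The number of cycles of a permutation, fixed points included. -/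
noncomputable def numCycles (f : Perm X) : ℕ := (SameCycle.setoid f).numClasses

/-- Being in the same orbit under the group generated by two permutations. -/
def jointSetoid (f g : Perm X) : Setoid X := SameCycle.setoid f ⊔ SameCycle.setoid g

theorem numCycles_one : (1 : Perm X).numCycles = Nat.card X := by
  refine (Nat.card_congr (Equiv.ofBijective (Quotient.mk (SameCycle.setoid (1 : Perm X))) ?_)).symm
  refine ⟨fun a b h => ?_, Quotient.mk_surjective⟩
  have : (1 : Perm X).SameCycle a b := Quotient.exact h
  simpa using this

theorem jointSetoid_left (f g : Perm X) (x : X) : jointSetoid f g x (f x) :=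
  (le_sup_left : SameCycle.setoid f ≤ _) (setoid_apply_self f x)

theorem jointSetoid_right (f g : Perm X) (x : X) : jointSetoid f g x (g x) :=
  (le_sup_right : SameCycle.setoid g ≤ _) (setoid_apply_self g x)

/-- The number of cycles of `f` and of `f * g`, minus twice the number of joint orbits. -/
noncomputable def excess (f g : Perm X) : ℤ :=
  f.numCycles + (f * g).numCycles - 2 * (jointSetoid f g).numClasses

/-- The pair `f`, `g` describes a disjoint union of maps of genus 0. -/
def IsPlanarPair (f g : Perm X) : Prop := excess f g = Nat.card X - g.numCycles

variable [Finite X]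

theorem SameCycle.mem_of_mapsTo {S : Set X} (h : f.SameCycle x y) (hS : ∀ z ∈ S, f z ∈ S)
    (hx : x ∈ S) : y ∈ S := by
  obtain ⟨n, rfl⟩ := h.exists_nat_pow_eq
  induction n with
  | zero => exact hx
  | succ n ih =>
    rw [pow_succ', mul_apply]
    exact hS _ (ih ⟨n, by simp⟩)

theorem setoid_le_iff {t : Setoid X} : SameCycle.setoid f ≤ t ↔ ∀ x, t x (f x) := by
  constructor
  · intro h x
    exact h (⟨1, by simp⟩ : f.SameCycle x (f x))
  · intro h x y hxy
    exact SameCycle.mem_of_mapsTo (S := {z | t x z}) hxy (fun z hz => t.trans' hz (h z)) (t.refl' x)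

theorem setoid_mul_le (f g : Perm X) :
    SameCycle.setoid (f * g) ≤ SameCycle.setoid f ⊔ SameCycle.setoid g := by
  rw [setoid_le_iff]
  intro x
  exact Setoid.trans' _
    ((le_sup_right : SameCycle.setoid g ≤ _) (setoid_apply_self g x))
    ((le_sup_left : SameCycle.setoid f ≤ _) (setoid_apply_self f (g x)))

theorem jointSetoid_one (g : Perm X) : jointSetoid 1 g = SameCycle.setoid g := by
  apply le_antisymm (sup_le ?_ le_rfl) le_sup_right
  rw [setoid_le_iff]
  exact fun x => Setoid.refl' _ x

theorem excess_one (g : Perm X) : excess 1 g = Nat.card X - g.numCycles := by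
  rw [excess, jointSetoid_one, numCycles_one, one_mul]
  change _ + _ - 2 * (g.numCycles : ℤ) = _
  ring

variable [DecidableEq X]

/-- Following `i`, the product agrees with `f` until `f` would return to `i`; there the
transposition diverts it to `j`. If that never happened, `f` would never return to `i`, against its
finite order. -/
theorem SameCycle.swap_mul_of_not (h : ¬ f.SameCycle i j) : (swap i j * f).SameCycle i j := by
  by_contra hg
  have key : ∀ t : ℕ, ((swap i j * f) ^ t) i = (f ^ t) i ∧ (f ^ (t + 1)) i ≠ i := by
    have step : ∀ t : ℕ, ((swap i j * f) ^ t) i = (f ^ t) i → (f ^ (t + 1)) i ≠ i := by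
      intro t ht hi
      apply hg
      refine ⟨(t + 1 : ℕ), ?_⟩
      rw [zpow_natCast, pow_succ', mul_apply, ht, mul_apply, ← mul_apply f, ← pow_succ', hi,
        swap_apply_left]
    intro t
    induction t with
    | zero => exact ⟨by simp, step 0 (by simp)⟩
    | succ t ih =>
      have : ((swap i j * f) ^ (t + 1)) i = (f ^ (t + 1)) i := by
        rw [pow_succ', mul_apply, ih.1, mul_apply, ← mul_apply f, ← pow_succ']
        refine swap_apply_of_ne_of_ne ih.2 fun hj => h ⟨(t + 1 : ℕ), ?_⟩
        rw [zpow_natCast, hj]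
      exact ⟨this, step _ this⟩
  have hpos := orderOf_pos f
  apply (key (orderOf f - 1)).2
  rw [Nat.sub_add_cancel hpos, pow_orderOf_eq_one, one_apply]

/-- With `k` minimal such that `f ^ k` takes `i` to `j`, the product closes up the segment of the
first `k` iterates of `i`, which does not contain `j`. -/
theorem SameCycle.not_swap_mul (h : f.SameCycle i j) (hij : i ≠ j) :
    ¬ (swap i j * f).SameCycle i j := by
  classical
  intro hg
  have hex := h.exists_nat_pow_eq
  let k := Nat.find hex
  have hk : (f ^ k) i = j := Nat.find_spec hex
  have hmin : ∀ t < k, (f ^ t) i ≠ j := fun t ht => Nat.find_min hex ht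
  have hk0 : 0 < k := by
    rcases Nat.eq_zero_or_pos k with h0 | h0
    · rw [h0] at hk; exact absurd hk hij
    · exact h0
  have hi : ∀ t, 0 < t → t < k → (f ^ t) i ≠ i := by
    intro t h0 ht hti
    apply hmin (k - t) (by omega)
    rw [← hk]
    conv_rhs => rw [show k = (k - t) + t by omega, pow_add, mul_apply, hti]
  have : j ∈ {z | ∃ t < k, (f ^ t) i = z} := by
    refine hg.mem_of_mapsTo ?_ ⟨0, hk0, by simp⟩
    rintro z ⟨t, ht, rfl⟩
    rw [mul_apply, ← mul_apply f, ← pow_succ']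
    rcases Nat.lt_or_ge (t + 1) k with h1 | h1
    · rw [swap_apply_of_ne_of_ne (hi _ (by omega) h1) (hmin _ h1)]
      exact ⟨t + 1, h1, _root_.rfl⟩
    · rw [show t + 1 = k by omega, hk, swap_apply_right]
      exact ⟨0, hk0, by simp⟩
  obtain ⟨t, ht, h'⟩ := this
  exact hmin t ht h'

theorem setoid_swap_mul_of_not_sameCycle (h : ¬ f.SameCycle i j) :
    SameCycle.setoid (swap i j * f) = (SameCycle.setoid f).adjoin i j := by
  have hg : SameCycle.setoid (swap i j * f) i j := SameCycle.swap_mul_of_not h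
  apply le_antisymm
  · rw [setoid_le_iff]
    intro x
    have hx := setoid_apply_self f x
    rw [mul_apply, swap_apply_def]
    split_ifs with h1 h2
    · rw [h1] at hx
      exact Or.inr ⟨Or.inl hx, Or.inr (Setoid.refl' _ _)⟩
    · rw [h2] at hx
      exact Or.inr ⟨Or.inr hx, Or.inl (Setoid.refl' _ _)⟩
    · exact Or.inl hx
  · refine Setoid.adjoin_le ?_ hg
    rw [setoid_le_iff]
    intro x
    have hx := setoid_apply_self (swap i j * f) x
    rw [mul_apply, swap_apply_def] at hx
    split_ifs at hx with h1 h2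
    · rw [h1]; exact Setoid.trans' _ hx (Setoid.symm' _ hg)
    · rw [h2]; exact Setoid.trans' _ hx hg
    · exact hx

theorem setoid_eq_adjoin_of_sameCycle (h : f.SameCycle i j) (hij : i ≠ j) :
    SameCycle.setoid f = (SameCycle.setoid (swap i j * f)).adjoin i j := by
  rw [← setoid_swap_mul_of_not_sameCycle (h.not_swap_mul hij), ← mul_assoc, swap_mul_self, one_mul]

theorem numCycles_swap_mul_of_sameCycle (h : f.SameCycle i j) (hij : i ≠ j) :
    (swap i j * f).numCycles = f.numCycles + 1 := by
  rw [numCycles, numCycles, setoid_eq_adjoin_of_sameCycle h hij]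
  exact Setoid.numClasses_adjoin (h.not_swap_mul hij)

theorem numCycles_swap_mul_of_not_sameCycle (h : ¬ f.SameCycle i j) :
    f.numCycles = (swap i j * f).numCycles + 1 := by
  rw [numCycles, numCycles, setoid_swap_mul_of_not_sameCycle h]
  exact Setoid.numClasses_adjoin h

theorem jointSetoid_eq_adjoin (f g : Perm X) (i : X) (hi : f i ≠ i) :
    jointSetoid f g = (jointSetoid (swap i (f i) * f) g).adjoin i (f i) := by
  rw [jointSetoid, setoid_eq_adjoin_of_sameCycle (setoid_apply_self f i) hi.symm,
    Setoid.adjoin_sup, jointSetoid]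

/-- When `i` is moved, `f` gains a cycle and `f * g` gains or loses one. If the joint orbits stay
the same, the change is 0 or 2. If an orbit splits, then `i` and `f i` must have been in one cycle
of `f * g`, which splits too, and the change is 1 + 1 - 2 = 0. -/
theorem excess_le_swap_mul (f g : Perm X) (i : X) :
    excess f g ≤ excess (swap i (f i) * f) g := by
  by_cases hi : f i = i
  · rw [hi, swap_self]; rfl
  have h1 := numCycles_swap_mul_of_sameCycle (setoid_apply_self f i) (Ne.symm hi)
  have hj := jointSetoid_eq_adjoin f g i hi
  unfold excess
  rw [hj, h1, mul_assoc]
  by_cases hJ : jointSetoid (swap i (f i) * f) g i (f i)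
  · rw [Setoid.adjoin_eq_self hJ]
    by_cases hs : (f * g).SameCycle i (f i)
    · have := numCycles_swap_mul_of_sameCycle hs (Ne.symm hi)
      push_cast; omega
    · have := numCycles_swap_mul_of_not_sameCycle hs
      push_cast; omega
  · have h2 := Setoid.numClasses_adjoin hJ
    have hs : (f * g).SameCycle i (f i) := by
      by_contra hs
      have hs' := SameCycle.swap_mul_of_not hs
      rw [← mul_assoc] at hs'
      exact hJ (setoid_mul_le _ _ hs')
    have := numCycles_swap_mul_of_sameCycle hs (Ne.symm hi)
    push_cast; omega

/-- The genus of a pair of permutations is not negative. -/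
theorem excess_le (f g : Perm X) : excess f g ≤ Nat.card X - g.numCycles := by
  induction hn : {x | f x ≠ x}.ncard using Nat.strong_induction_on generalizing f with
  | _ n ih =>
    by_cases hf : ∃ i, f i ≠ i
    · obtain ⟨i, hi⟩ := hf
      refine (excess_le_swap_mul f g i).trans (ih _ ?_ _ rfl)
      rw [← hn]
      exact Set.ncard_lt_ncard (support_swap_apply_mul_ssubset f i hi) (Set.toFinite _)
    · push Not at hf
      rw [show f = 1 from Equiv.ext hf, excess_one]

theorem IsPlanarPair.swap_mul (h : IsPlanarPair f g) (i : X) :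
    IsPlanarPair (swap i (f i) * f) g :=
  le_antisymm (excess_le _ _) (h.ge.trans (excess_le_swap_mul f g i))

end Equiv.Perm

/-! ### Class sizes -/

namespace Setoid

variable {X : Type*}

/-- The size of the class of an element. -/
noncomputable def classCard (r : Setoid X) (x : X) : ℕ := {y | r x y}.ncard

theorem classCard_pos [Finite X] (r : Setoid X) (x : X) : 0 < r.classCard x :=
  (Set.ncard_pos (Set.toFinite _)).2 ⟨x, r.refl' x⟩

theorem setOf_rel_eq {r : Setoid X} {x y : X} (h : r x y) : {z | r x z} = {z | r y z} :=
  Set.ext fun _ => ⟨fun k => r.trans' (r.symm' h) k, fun k => r.trans' h k⟩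

theorem classCard_eq {r : Setoid X} {x y : X} (h : r x y) : r.classCard x = r.classCard y := by
  rw [classCard, setOf_rel_eq h, classCard]

theorem sum_class_inv_classCard [Fintype X] (r : Setoid X) (x : X) [DecidablePred (r x)] :
    ∑ y with r x y, (r.classCard y : ℚ)⁻¹ = 1 := by
  have : ∀ y ∈ Finset.univ.filter (fun y => r x y), (r.classCard y : ℚ)⁻¹ = (r.classCard x : ℚ)⁻¹ := by
    intro y hy
    rw [classCard_eq (Finset.mem_filter.1 hy).2]
  rw [Finset.sum_congr _root_.rfl this, Finset.sum_const, nsmul_eq_mul]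
  have h2 : r.classCard x = (Finset.univ.filter (fun y => r x y)).card := by
    rw [classCard, ← Set.ncard_coe_finset]; simp
  rw [← h2]
  exact mul_inv_cancel₀ (by exact_mod_cast (r.classCard_pos x).ne')

/-- Each class contributes 1. This turns Euler's formula into a sum over directed edges, which can
be restricted to a component. -/
theorem numClasses_eq_sum [Fintype X] (r : Setoid X) :
    (r.numClasses : ℚ) = ∑ x, (r.classCard x : ℚ)⁻¹ := by
  classical
  rw [← Finset.sum_fiberwise Finset.univ (Quotient.mk r)]
  have : ∀ q : Quotient r, ∑ x with Quotient.mk r x = q, (r.classCard x : ℚ)⁻¹ = 1 := by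
    intro q
    induction q using Quotient.inductionOn with | _ a
    rw [← r.sum_class_inv_classCard a]
    refine Finset.sum_congr (Finset.filter_congr fun x _ => ?_) fun _ _ => _root_.rfl
    exact ⟨fun h => r.symm' (Quotient.exact h), fun h => Quotient.sound (r.symm' h)⟩
  rw [Finset.sum_congr _root_.rfl fun q _ => this q]
  simp [numClasses]

theorem numClasses_le_card [Finite X] (r : Setoid X) : r.numClasses ≤ Nat.card X :=
  Nat.card_le_card_of_surjective _ Quotient.mk_surjective

end Setoid

theorem Finset.even_card_of_involution {X : Type*} (s : Finset X) (g : X → X)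
    (hg : ∀ x ∈ s, g x ∈ s) (hne : ∀ x ∈ s, g x ≠ x) (hinv : ∀ x ∈ s, g (g x) = x) :
    Even s.card := by
  have : ∑ _x ∈ s, (1 : ZMod 2) = 0 :=
    Finset.sum_involution (fun x _ => g x) (fun _ _ => by decide) (fun x hx _ => hne x hx)
      (fun x hx => hg x hx) (fun x hx => hinv x hx)
  rw [Finset.sum_const, nsmul_eq_mul, mul_one] at this
  exact (ZMod.natCast_eq_zero_iff_even).1 this

/-! ### Plane quadrangulations as pairs of permutations: no loops, Euler's formula -/

namespace Equiv.Perm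

variable {X : Type*} {f g α φ : Perm X} {x y i j : X}

/-- The pair consisting of the inversion `α` of directed edges and the face permutation `φ`
describes a disjoint union of plane quadrangulations. -/
structure IsPlaneQuadPair (α φ : Perm X) : Prop where
  invol : ∀ d, α (α d) = d
  ne : ∀ d, α d ≠ d
  four : ∀ d, φ (φ (φ (φ d))) = d
  two_ne : ∀ d, φ (φ d) ≠ d
  planar : IsPlanarPair α φ

variable [Finite X]

theorem sameCycle_iff_of_eqOn {S : Set X} (hS : ∀ z ∈ S, f z ∈ S) (hfg : ∀ z ∈ S, g z = f z)
    (hx : x ∈ S) : f.SameCycle x y ↔ g.SameCycle x y := by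
  constructor
  · intro h
    refine (h.mem_of_mapsTo (S := {z | z ∈ S ∧ g.SameCycle x z}) ?_ ⟨hx, SameCycle.refl _ _⟩).2
    rintro z ⟨hz, hz'⟩
    exact ⟨hS z hz, by rw [← hfg z hz]; exact hz'.trans (setoid_apply_self g z)⟩
  · intro h
    refine (h.mem_of_mapsTo (S := {z | z ∈ S ∧ f.SameCycle x z}) ?_ ⟨hx, SameCycle.refl _ _⟩).2
    rintro z ⟨hz, hz'⟩
    rw [hfg z hz]
    exact ⟨hS z hz, hz'.trans (setoid_apply_self f z)⟩

/-- Edges outside `O` are removed by transpositions, which preserve planarity because the excess is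
already maximal and cannot decrease. -/
theorem IsPlanarPair.exists_restrict [DecidableEq X] {O : Set X} (hO : ∀ x ∈ O, f x ∈ O)
    (h : IsPlanarPair f g) :
    ∃ f' : Perm X, IsPlanarPair f' g ∧ (∀ x ∈ O, f' x = f x) ∧ ∀ x ∉ O, f' x = x := by
  induction hn : {x | f x ≠ x}.ncard using Nat.strong_induction_on generalizing f with
  | _ n ih =>
    by_cases hf : ∃ i, i ∉ O ∧ f i ≠ i
    · obtain ⟨i, hi, hfi⟩ := hf
      have hval : ∀ x ∈ O, (swap i (f i) * f) x = f x := fun x hx =>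
        swap_apply_of_ne_of_ne (fun k => hi (k ▸ hO x hx)) fun k => hi (f.injective k ▸ hx)
      obtain ⟨f', h1, h2, h3⟩ := ih _
        (hn ▸ Set.ncard_lt_ncard (support_swap_apply_mul_ssubset f i hfi) (Set.toFinite _))
        (fun x hx => by rw [hval x hx]; exact hO x hx) (h.swap_mul i) _root_.rfl
      exact ⟨f', h1, fun x hx => (h2 x hx).trans (hval x hx), h3⟩
    · push Not at hf
      exact ⟨f, h, fun _ _ => _root_.rfl, hf⟩

theorem jointSetoid_mul (h : (f * g).SameCycle x y) : jointSetoid f g x y :=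
  setoid_mul_le f g h

theorem jointSetoid_le {t : Setoid X} (hf : ∀ x, t x (f x)) (hg : ∀ x, t x (g x)) :
    jointSetoid f g ≤ t :=
  sup_le (setoid_le_iff.2 hf) (setoid_le_iff.2 hg)

/-- A plane quadrangulation has no loops. -/
theorem IsPlaneQuadPair.not_sameCycle (h : IsPlaneQuadPair α φ) (d : X) :
    ¬ (α * φ).SameCycle d (α d) := by
  classical
  intro hd
  have hne : d ≠ α d := (h.ne d).symm
  set β := swap d (α d) * α with hβ
  have h1 := numCycles_swap_mul_of_sameCycle (setoid_apply_self α d) hne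
  have h2 := numCycles_swap_mul_of_sameCycle hd hne
  have h3 := h.planar.swap_mul d
  have h4 := h.planar
  rw [IsPlanarPair, excess] at h3 h4
  rw [← mul_assoc] at h2
  rw [← hβ] at h1 h2 h3
  -- Deleting the loop adds one cycle to `α` and one to `α * φ`; as both pairs are planar, the
  -- number of joint orbits must grow, so the loop separates.
  have hJ : ¬ jointSetoid β φ d (α d) := by
    intro hJ
    have := jointSetoid_eq_adjoin α φ d (h.ne d)
    rw [← hβ, Setoid.adjoin_eq_self hJ] at this
    rw [this] at h4
    omega
  have := Fintype.ofFinite X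
  set O : Finset X := Finset.univ.filter fun x => jointSetoid β φ d x with hO
  have memO : ∀ x, x ∈ O ↔ jointSetoid β φ d x := fun x => by simp [hO]
  have hφO : ∀ x ∈ O, φ x ∈ O := fun x hx =>
    (memO _).2 (Setoid.trans' _ ((memO _).1 hx) (jointSetoid_right β φ x))
  have hβO : ∀ x ∈ O, β x ∈ O := fun x hx =>
    (memO _).2 (Setoid.trans' _ ((memO _).1 hx) (jointSetoid_left β φ x))
  have hdO : d ∈ O := (memO _).2 (Setoid.refl' _ _)
  -- One side of the loop is counted in two ways. Opposite directed edges of a face pair up all of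
  -- `O`; inversion pairs up all of `O` except `d`, whose inverse is on the other side.
  have e1 : Even O.card := O.even_card_of_involution (fun x => φ (φ x))
    (fun x hx => hφO _ (hφO _ hx)) (fun x _ => h.two_ne x) fun x _ => h.four x
  have hval : ∀ x ∈ O.erase d, β x = α x := by
    intro x hx
    obtain ⟨hxd, hxO⟩ := Finset.mem_erase.1 hx
    refine swap_apply_of_ne_of_ne (fun k => ?_) fun k => hxd (α.injective k)
    have : x = α d := by rw [← k, h.invol]
    exact hJ (this ▸ (memO _).1 hxO)
  have hβd : ∀ x ∈ O.erase d, β x ∈ O.erase d := by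
    intro x hx
    obtain ⟨hxd, hxO⟩ := Finset.mem_erase.1 hx
    refine Finset.mem_erase.2 ⟨fun k => hxd (β.injective ?_), hβO x hxO⟩
    rw [k, hβ]; simp
  have e2 : Even (O.erase d).card := (O.erase d).even_card_of_involution β hβd
    (fun x hx => by rw [hval x hx]; exact h.ne x)
    fun x hx => by rw [hval _ (hβd x hx), hval x hx, h.invol]
  rw [Finset.card_erase_of_mem hdO] at e2
  have : 0 < O.card := Finset.card_pos.2 ⟨d, hdO⟩
  rcases e1 with ⟨a, ha⟩
  rcases e2 with ⟨b, hb⟩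
  omega

theorem ncard_face (h4 : φ (φ (φ (φ x))) = x) (h2 : φ (φ x) ≠ x) :
    (SameCycle.setoid φ).classCard x = 4 := by
  have key : {y | SameCycle.setoid φ x y} = {x, φ x, φ (φ x), φ (φ (φ x))} := by
    ext y
    constructor
    · intro h
      refine SameCycle.mem_of_mapsTo (f := φ) h ?_ (by simp)
      rintro z (rfl | rfl | rfl | rfl)
      · simp
      · simp
      · simp
      · rw [h4]; simp
    · have s := setoid_apply_self φ
      rintro (rfl | rfl | rfl | rfl)
      · exact Setoid.refl' (SameCycle.setoid φ) _
      · exact s x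
      · exact Setoid.trans' _ (s x) (s _)
      · exact Setoid.trans' _ (Setoid.trans' _ (s x) (s _)) (s _)
  have h1 : φ x ≠ x := fun k => h2 (by rw [k, k])
  have h3 : φ (φ (φ x)) ≠ x := fun k => h1 (by rwa [k] at h4)
  have inj := φ.injective
  rw [Setoid.classCard, key, Set.ncard_insert_of_notMem, Set.ncard_insert_of_notMem,
    Set.ncard_pair]
  · exact fun k => h1 (inj (inj k.symm))
  · rintro (k | k)
    · exact h1 (inj k.symm)
    · exact h2 (inj k.symm)
  · rintro (k | k | k)
    · exact h1 k.symm
    · exact h2 k.symm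
    · exact h3 k.symm

/-- Euler's formula for a component of a planar pair. -/
theorem IsPlaneQuadPair.sum_component [Fintype X] (h : IsPlaneQuadPair α φ) (e : X)
    [DecidablePred (jointSetoid α φ e)] :
    ∑ x with jointSetoid α φ e x, (((SameCycle.setoid (α * φ)).classCard x : ℚ)⁻¹ - 1 / 4) = 2 := by
  classical
  set O : Set X := {x | jointSetoid α φ e x} with hO
  have heO : e ∈ O := Setoid.refl' (jointSetoid α φ) e
  have hαO : ∀ x ∈ O, α x ∈ O := fun x hx => Setoid.trans' _ hx (jointSetoid_left α φ x)
  have hφO : ∀ x ∈ O, φ x ∈ O := fun x hx => Setoid.trans' _ hx (jointSetoid_right α φ x)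
  have hφO' : ∀ x ∉ O, φ x ∉ O := fun x hx k =>
    hx (Setoid.trans' _ k (Setoid.symm' _ (jointSetoid_right α φ x)))
  obtain ⟨β, hβ, hβO, hβO'⟩ := h.planar.exists_restrict hαO
  -- Euler's formula for the restricted pair, written as a sum over directed edges. Outside `O` the
  -- only nontrivial permutation is `φ`, whose cycles are then both the vertices and the components,
  -- so the terms vanish there.
  have key : ∑ x : X, (((SameCycle.setoid β).classCard x : ℚ)⁻¹ +
      ((SameCycle.setoid (β * φ)).classCard x : ℚ)⁻¹ + ((SameCycle.setoid φ).classCard x : ℚ)⁻¹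
      - 2 * ((jointSetoid β φ).classCard x : ℚ)⁻¹ - 1) = 0 := by
    simp only [Finset.sum_sub_distrib, Finset.sum_add_distrib, ← Finset.mul_sum,
      ← Setoid.numClasses_eq_sum]
    have := hβ
    rw [IsPlanarPair, excess, numCycles, numCycles, numCycles, Nat.card_eq_fintype_card] at this
    have : ((_ : ℤ) : ℚ) = ((_ : ℤ) : ℚ) := congrArg Int.cast this
    push_cast at this
    simp only [Finset.sum_const, Finset.card_univ, nsmul_eq_mul, mul_one]
    linarith
  have hout : ∀ x ∉ O, (((SameCycle.setoid β).classCard x : ℚ)⁻¹ +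
      ((SameCycle.setoid (β * φ)).classCard x : ℚ)⁻¹ + ((SameCycle.setoid φ).classCard x : ℚ)⁻¹
      - 2 * ((jointSetoid β φ).classCard x : ℚ)⁻¹ - 1) = 0 := by
    intro x hx
    have c1 : (SameCycle.setoid β).classCard x = 1 := by
      rw [Setoid.classCard, Set.ncard_eq_one]
      refine ⟨x, Set.eq_singleton_iff_unique_mem.2 ⟨Setoid.refl' (SameCycle.setoid β) x, fun y hy => ?_⟩⟩
      refine SameCycle.mem_of_mapsTo (f := β) (S := {x}) hy ?_ _root_.rfl
      rintro z rfl
      exact hβO' z hx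
    have c2 : (SameCycle.setoid (β * φ)).classCard x = (SameCycle.setoid φ).classCard x := by
      rw [Setoid.classCard, Setoid.classCard]
      congr 1
      ext y
      exact (sameCycle_iff_of_eqOn (S := Oᶜ) (f := φ) (g := β * φ) hφO'
        (fun z hz => hβO' _ (hφO' z hz)) hx).symm
    have c3 : (jointSetoid β φ).classCard x = (SameCycle.setoid φ).classCard x := by
      rw [Setoid.classCard, Setoid.classCard]
      congr 1
      ext y
      refine ⟨fun hy => ?_, fun hy => (le_sup_right : SameCycle.setoid φ ≤ _) hy⟩
      -- This relation has `O` as one class and the cycles of `φ` as classes outside. Both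
      -- permutations respect it, so it bounds the joint orbits outside `O`.
      let t : Setoid X :=
        { r := fun a b => (a ∈ O ↔ b ∈ O) ∧ (a ∉ O → SameCycle.setoid φ a b)
          iseqv := ⟨fun a => ⟨Iff.rfl, fun _ => Setoid.refl' _ a⟩,
            fun ⟨p, q⟩ => ⟨p.symm, fun k => Setoid.symm' _ (q (fun l => k (p.1 l)))⟩,
            fun ⟨p, q⟩ ⟨p', q'⟩ => ⟨p.trans p', fun k =>
              Setoid.trans' _ (q k) (q' fun l => k (p.2 l))⟩⟩ }
      have hle : jointSetoid β φ ≤ t := by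
        refine jointSetoid_le (fun z => ?_) fun z => ?_
        · by_cases hz : z ∈ O
          · exact ⟨⟨fun _ => by rw [hβO z hz]; exact hαO z hz, fun _ => hz⟩, fun k => absurd hz k⟩
          · rw [hβO' z hz]
        · exact ⟨⟨fun k => hφO z k, fun k => by_contra fun l => hφO' z l k⟩,
            fun _ => setoid_apply_self φ z⟩
      exact (hle hy).2 hx
    rw [c1, c2, c3]
    ring
  have hin : ∀ x ∈ O, (((SameCycle.setoid β).classCard x : ℚ)⁻¹ +
      ((SameCycle.setoid (β * φ)).classCard x : ℚ)⁻¹ + ((SameCycle.setoid φ).classCard x : ℚ)⁻¹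
      - 2 * ((jointSetoid β φ).classCard x : ℚ)⁻¹ - 1) =
      (((SameCycle.setoid (α * φ)).classCard x : ℚ)⁻¹ - 1 / 4) - 2 * (O.ncard : ℚ)⁻¹ := by
    intro x hx
    have c1 : (SameCycle.setoid β).classCard x = 2 := by
      rw [Setoid.classCard, Set.ncard_eq_two]
      refine ⟨x, α x, (h.ne x).symm, Set.ext fun y => ⟨fun hy => ?_, ?_⟩⟩
      · refine SameCycle.mem_of_mapsTo (f := β) hy ?_ (by simp)
        rintro z (rfl | rfl)
        · rw [hβO z hx]; simp
        · rw [hβO _ (hαO x hx), h.invol]; simp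
      · rintro (rfl | rfl)
        · exact Setoid.refl' (SameCycle.setoid β) _
        · rw [← hβO x hx]; exact setoid_apply_self β x
    have c2 : (SameCycle.setoid (β * φ)).classCard x = (SameCycle.setoid (α * φ)).classCard x := by
      rw [Setoid.classCard, Setoid.classCard]
      congr 1
      ext y
      exact (sameCycle_iff_of_eqOn (S := O) (f := α * φ) (g := β * φ)
        (fun z hz => hαO _ (hφO z hz)) (fun z hz => hβO _ (hφO z hz)) hx).symm
    have c3 : (jointSetoid β φ).classCard x = O.ncard := by
      rw [Setoid.classCard]
      congr 1
      -- Here the complement of `O` is one class. Inside `O` the permutations `α` and `β` agree, so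
      -- the orbit `O` of `α` and `φ` stays a single orbit.
      let t : Setoid X :=
        { r := fun a b => (a ∈ O ↔ b ∈ O) ∧ (a ∈ O → jointSetoid β φ a b)
          iseqv := ⟨fun a => ⟨Iff.rfl, fun _ => Setoid.refl' _ a⟩,
            fun ⟨p, q⟩ => ⟨p.symm, fun k => Setoid.symm' _ (q (p.2 k))⟩,
            fun ⟨p, q⟩ ⟨p', q'⟩ => ⟨p.trans p', fun k => Setoid.trans' _ (q k) (q' (p.1 k))⟩⟩ }
      have hφt : ∀ z, t z (φ z) := fun z =>
        ⟨⟨fun k => hφO z k, fun k => by_contra fun l => hφO' z l k⟩,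
            fun _ => jointSetoid_right β φ z⟩
      have hle : jointSetoid α φ ≤ t := by
        refine jointSetoid_le (fun z => ?_) hφt
        refine ⟨⟨hαO z, fun k => by have := hαO _ k; rwa [h.invol] at this⟩, fun hz => ?_⟩
        rw [← hβO z hz]
        exact jointSetoid_left β φ z
      have hle' : jointSetoid β φ ≤ jointSetoid α φ := by
        refine jointSetoid_le (fun z => ?_) (jointSetoid_right α φ)
        by_cases hz : z ∈ O
        · rw [hβO z hz]; exact jointSetoid_left α φ z
        · rw [hβO' z hz]
      ext y
      refine ⟨fun hy => Setoid.trans' _ hx (hle' hy), fun hy => (hle ?_).2 hx⟩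
      exact Setoid.trans' _ (Setoid.symm' _ hx) hy
    rw [c1, c2, c3, ncard_face (h.four x) (h.two_ne x)]
    push_cast
    ring
  have hsplit := Finset.sum_filter_add_sum_filter_not Finset.univ
    (fun x => jointSetoid α φ e x) (fun x => (((SameCycle.setoid β).classCard x : ℚ)⁻¹ +
      ((SameCycle.setoid (β * φ)).classCard x : ℚ)⁻¹ + ((SameCycle.setoid φ).classCard x : ℚ)⁻¹
      - 2 * ((jointSetoid β φ).classCard x : ℚ)⁻¹ - 1))
  have hin' := Finset.sum_congr (s₁ := Finset.univ.filter fun x => jointSetoid α φ e x)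
    _root_.rfl fun x hx => hin x (Finset.mem_filter.1 hx).2
  have hout' := Finset.sum_eq_zero (s := Finset.univ.filter fun x => ¬ jointSetoid α φ e x)
    fun x hx => hout x (Finset.mem_filter.1 hx).2
  rw [key, hin', hout', add_zero,
    Finset.sum_sub_distrib, Finset.sum_const, nsmul_eq_mul] at hsplit
  have hcard : ((Finset.univ.filter fun x => jointSetoid α φ e x).card : ℚ) = O.ncard := by
    rw [hO, ← Set.ncard_coe_finset]; simp
  have hpos : (O.ncard : ℚ) ≠ 0 := by
    exact_mod_cast ((Set.ncard_pos (Set.toFinite _)).2 ⟨e, heO⟩).ne'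
  rw [hcard] at hsplit
  have : (O.ncard : ℚ) * (2 * (O.ncard : ℚ)⁻¹) = 2 := by field_simp
  linarith

end Equiv.Perm

/-! ### Cutting along two parallel edges, and the vertex of small degree -/

namespace Equiv.Perm

variable {X : Type*} {α φ : Perm X} {d₁ d₂ e d : X}

/-- The directed edges `d₁` and `d₂` are parallel and distinct. -/
structure IsParallel (α φ : Perm X) (d₁ d₂ : X) : Prop where
  ne : d₁ ≠ d₂
  start : (α * φ).SameCycle d₁ d₂
  target : (α * φ).SameCycle (α d₁) (α d₂)

theorem IsParallel.symm (h : IsParallel α φ d₁ d₂) : IsParallel α φ d₂ d₁ :=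
  ⟨h.ne.symm, h.start.symm, h.target.symm⟩

theorem IsParallel.ne_inv [Finite X] (h : IsPlaneQuadPair α φ) (hp : IsParallel α φ d₁ d₂) : d₁ ≠ α d₂ :=
  fun k => h.not_sameCycle d₂ (k ▸ hp.start.symm)

/-- The start of `d` has at most three directed edges, and no two of them are parallel. -/
structure IsReducible (α φ : Perm X) (d : X) : Prop where
  card : (α * φ) d = d ∨ (α * φ) ((α * φ) d) = d ∨ (α * φ) ((α * φ) ((α * φ) d)) = d
  simple : ∀ d' d'', (α * φ).SameCycle d d' → (α * φ).SameCycle d d'' → ¬ IsParallel α φ d' d''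

variable [DecidableEq X]

/-- The inversion of directed edges after cutting along the closed walk that consists of the
parallel directed edges `d₁` and `d₂`. -/
def cutInversion (α : Perm X) (d₁ d₂ : X) : Perm X :=
  swap d₁ d₂ * (swap (α d₁) (α d₂) * α)

theorem cutInversion_comm (α : Perm X) (d₁ d₂ : X) :
    cutInversion α d₁ d₂ = cutInversion α d₂ d₁ := by
  rw [cutInversion, cutInversion, swap_comm, swap_comm (α d₁)]

theorem cutInversion_apply_left (hne : ∀ d, α d ≠ d) (h : d₁ ≠ α d₂) :
    cutInversion α d₁ d₂ d₁ = α d₂ := by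
  rw [cutInversion, mul_apply, mul_apply, swap_apply_left, swap_apply_of_ne_of_ne h.symm (hne _)]

theorem cutInversion_apply_right (hne : ∀ d, α d ≠ d) (h : d₂ ≠ α d₁) :
    cutInversion α d₁ d₂ d₂ = α d₁ := by
  rw [cutInversion_comm, cutInversion_apply_left hne h]

theorem cutInversion_apply_inv_left (hinv : ∀ d, α (α d) = d) (h : d₁ ≠ α d₁) (h' : d₁ ≠ α d₂) :
    cutInversion α d₁ d₂ (α d₁) = d₂ := by
  rw [cutInversion, mul_apply, mul_apply, hinv, swap_apply_of_ne_of_ne h h', swap_apply_left]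

theorem cutInversion_apply_inv_right (hinv : ∀ d, α (α d) = d) (h : d₂ ≠ α d₂) (h' : d₂ ≠ α d₁) :
    cutInversion α d₁ d₂ (α d₂) = d₁ := by
  rw [cutInversion_comm, cutInversion_apply_inv_left hinv h h']

theorem cutInversion_apply_of_ne (hinv : ∀ d, α (α d) = d) (h1 : d ≠ d₁) (h2 : d ≠ d₂)
    (h3 : d ≠ α d₁) (h4 : d ≠ α d₂) : cutInversion α d₁ d₂ d = α d := by
  rw [cutInversion, mul_apply, mul_apply,
    swap_apply_of_ne_of_ne (fun k => h1 (α.injective k)) fun k => h2 (α.injective k),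
    swap_apply_of_ne_of_ne]
  · exact fun k => h3 (by rw [← k, hinv])
  · exact fun k => h4 (by rw [← k, hinv])

variable [Finite X]

/-- Each of the two transpositions splits one end of the digon. The first leaves `d₁` and `d₂` in
one cycle because there are no loops, so the second really splits. -/
theorem setoid_cutInversion (h : IsPlaneQuadPair α φ) (hp : IsParallel α φ d₁ d₂) :
    SameCycle.setoid (α * φ) =
      ((SameCycle.setoid (cutInversion α d₁ d₂ * φ)).adjoin d₁ d₂).adjoin (α d₁) (α d₂) ∧
    (cutInversion α d₁ d₂ * φ).numCycles = (α * φ).numCycles + 2 := by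
  have hne' : α d₁ ≠ α d₂ := fun k => hp.ne (α.injective k)
  have e1 := setoid_eq_adjoin_of_sameCycle hp.target hne'
  have hloop : ∀ x, (swap (α d₁) (α d₂) * (α * φ)).SameCycle d₁ x → (α * φ).SameCycle d₁ x :=
    fun x hx => e1.ge (Setoid.le_adjoin _ _ _ hx)
  have n1 : ¬ (α * φ).SameCycle d₁ (α d₁) := h.not_sameCycle d₁
  have n2 : ¬ (α * φ).SameCycle d₁ (α d₂) := fun k => n1 (k.trans hp.target.symm)
  have hs : (swap (α d₁) (α d₂) * (α * φ)).SameCycle d₁ d₂ := by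
    have := e1.le hp.start
    rcases this with k | ⟨k | k, -⟩
    · exact k
    · exact absurd (hloop _ k) n1
    · exact absurd (hloop _ k) n2
  have e2 := setoid_eq_adjoin_of_sameCycle hs hp.ne
  have e3 : cutInversion α d₁ d₂ * φ = swap d₁ d₂ * (swap (α d₁) (α d₂) * (α * φ)) := by
    simp only [cutInversion, mul_assoc]
  rw [e3, numCycles_swap_mul_of_sameCycle hs hp.ne,
    numCycles_swap_mul_of_sameCycle hp.target hne', ← e2, ← e1]
  exact ⟨rfl, rfl⟩

theorem numCycles_cutInversion (h : IsPlaneQuadPair α φ) (hp : IsParallel α φ d₁ d₂) :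
    (cutInversion α d₁ d₂).numCycles = α.numCycles := by
  have n1 : ¬ α.SameCycle (α d₁) (α d₂) := by
    intro k
    have : α d₂ ∈ ({d₁, α d₁} : Set X) := by
      refine k.mem_of_mapsTo ?_ (by simp)
      rintro z (rfl | rfl)
      · simp
      · rw [h.invol]; simp
    rcases this with k | k
    · exact hp.ne_inv h k.symm
    · exact hp.ne (α.injective k).symm
  have e1 := numCycles_swap_mul_of_not_sameCycle n1
  have hs : (swap (α d₁) (α d₂) * α).SameCycle d₁ d₂ := by
    refine ⟨2, ?_⟩
    change (swap (α d₁) (α d₂)) (α ((swap (α d₁) (α d₂)) (α d₁))) = d₂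
    rw [swap_apply_left, h.invol, swap_apply_of_ne_of_ne (hp.symm.ne_inv h) (h.ne _).symm]
  rw [cutInversion, numCycles_swap_mul_of_sameCycle hs hp.ne, e1]

theorem jointSetoid_cutInversion_le (h : IsPlaneQuadPair α φ) (hp : IsParallel α φ d₁ d₂) :
    jointSetoid (cutInversion α d₁ d₂) φ ≤ jointSetoid α φ := by
  refine jointSetoid_le (fun x => ?_) (jointSetoid_right α φ)
  have h12 : jointSetoid α φ d₁ d₂ := jointSetoid_mul hp.start
  have i := jointSetoid_left α φ
  have a1 := hp.ne_inv h
  have a2 := hp.symm.ne_inv h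
  have t := fun {x y z} => (jointSetoid α φ).trans' (x := x) (y := y) (z := z)
  have s := fun {x y} => (jointSetoid α φ).symm' (x := x) (y := y)
  by_cases h1 : x = d₁
  · rw [h1, cutInversion_apply_left h.ne a1]; exact t h12 (i _)
  by_cases h2 : x = d₂
  · rw [h2, cutInversion_apply_right h.ne a2]; exact t (s h12) (i _)
  by_cases h3 : x = α d₁
  · rw [h3, cutInversion_apply_inv_left h.invol (h.ne _).symm a1]; exact t (s (i _)) h12
  by_cases h4 : x = α d₂
  · rw [h4, cutInversion_apply_inv_right h.invol (h.ne _).symm a2]; exact t (s (i _)) (s h12)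
  rw [cutInversion_apply_of_ne h.invol h1 h2 h3 h4]; exact i x

theorem le_adjoin_jointSetoid_cutInversion (h : IsPlaneQuadPair α φ)
    (hp : IsParallel α φ d₁ d₂) :
    jointSetoid α φ ≤ (jointSetoid (cutInversion α d₁ d₂) φ).adjoin d₁ d₂ := by
  have hle := Setoid.le_adjoin (jointSetoid (cutInversion α d₁ d₂) φ) d₁ d₂
  have h12 := Setoid.adjoin_rel (jointSetoid (cutInversion α d₁ d₂) φ) d₁ d₂
  have a1 := hp.ne_inv h
  have a2 := hp.symm.ne_inv h
  refine jointSetoid_le (fun x => ?_) fun x => hle (jointSetoid_right _ φ x)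
  have i := fun x => hle (jointSetoid_left (cutInversion α d₁ d₂) φ x)
  set r := (jointSetoid (cutInversion α d₁ d₂) φ).adjoin d₁ d₂
  have t := fun {x y z} => r.trans' (x := x) (y := y) (z := z)
  have s := fun {x y} => r.symm' (x := x) (y := y)
  have i1 := i d₁
  have i2 := i d₂
  rw [cutInversion_apply_left h.ne a1] at i1
  rw [cutInversion_apply_right h.ne a2] at i2
  by_cases h1 : x = d₁
  · rw [h1]; exact t h12 i2
  by_cases h2 : x = d₂
  · rw [h2]; exact t (s h12) i1
  by_cases h3 : x = α d₁
  · rw [h3, h.invol]; exact s (t h12 i2)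
  by_cases h4 : x = α d₂
  · rw [h4, h.invol]; exact s (t (s h12) i1)
  rw [← cutInversion_apply_of_ne h.invol h1 h2 h3 h4]; exact i x

/-- The combinatorial Jordan curve theorem for a digon: the cut adds two vertices and changes
neither the number of edges nor that of faces, so the genus inequality forces a new component;
regluing `d₁` to `d₂` shows that there is only one. -/
theorem numClasses_cutInversion (h : IsPlaneQuadPair α φ) (hp : IsParallel α φ d₁ d₂) :
    (jointSetoid (cutInversion α d₁ d₂) φ).numClasses = (jointSetoid α φ).numClasses + 1 := by
  have h1 := Setoid.numClasses_le_of_le (le_adjoin_jointSetoid_cutInversion h hp)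
  have h2 := Setoid.numClasses_le_adjoin_add_one (jointSetoid (cutInversion α d₁ d₂) φ) d₁ d₂
  have h3 := excess_le (cutInversion α d₁ d₂) φ
  have h4 := h.planar
  rw [IsPlanarPair, excess] at h4
  rw [excess, numCycles_cutInversion h hp, (setoid_cutInversion h hp).2] at h3
  push_cast at h3
  omega

theorem not_jointSetoid_cutInversion (h : IsPlaneQuadPair α φ) (hp : IsParallel α φ d₁ d₂) :
    ¬ jointSetoid (cutInversion α d₁ d₂) φ d₁ d₂ := by
  intro k
  have h1 := Setoid.numClasses_le_of_le (le_adjoin_jointSetoid_cutInversion h hp)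
  rw [Setoid.adjoin_eq_self k, numClasses_cutInversion h hp] at h1
  omega

theorem IsPlaneQuadPair.cutInversion (h : IsPlaneQuadPair α φ) (hp : IsParallel α φ d₁ d₂) :
    IsPlaneQuadPair (cutInversion α d₁ d₂) φ := by
  have a1 := hp.ne_inv h
  have a2 := hp.symm.ne_inv h
  have e1 := cutInversion_apply_left h.ne a1
  have e2 := cutInversion_apply_right h.ne a2
  have e3 := cutInversion_apply_inv_left h.invol (h.ne _).symm a1
  have e4 := cutInversion_apply_inv_right h.invol (h.ne _).symm a2
  have key : ∀ d, Equiv.Perm.cutInversion α d₁ d₂ (Equiv.Perm.cutInversion α d₁ d₂ d) = d ∧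
      Equiv.Perm.cutInversion α d₁ d₂ d ≠ d := by
    intro x
    by_cases h1 : x = d₁
    · rw [h1, e1]; exact ⟨e4, a1.symm⟩
    by_cases h2 : x = d₂
    · rw [h2, e2]; exact ⟨e3, a2.symm⟩
    by_cases h3 : x = α d₁
    · rw [h3, e3]; exact ⟨e2, a2⟩
    by_cases h4 : x = α d₂
    · rw [h4, e4]; exact ⟨e1, a1⟩
    rw [cutInversion_apply_of_ne h.invol h1 h2 h3 h4, cutInversion_apply_of_ne h.invol]
    · exact ⟨h.invol x, h.ne x⟩
    · exact fun k => h3 (by rw [← k, h.invol])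
    · exact fun k => h4 (by rw [← k, h.invol])
    · exact fun k => h1 (α.injective k)
    · exact fun k => h2 (α.injective k)
  refine ⟨fun d => (key d).1, fun d => (key d).2, h.four, h.two_ne, ?_⟩
  have h4 := h.planar
  rw [IsPlanarPair, excess] at h4 ⊢
  rw [numCycles_cutInversion h hp, (setoid_cutInversion h hp).2, numClasses_cutInversion h hp]
  push_cast
  omega

/-- Of the two pieces of each split vertex only one lies on the side of `d₂`, so on that side no two
directed edges lose their common start. -/
theorem sameCycle_cutInversion (h : IsPlaneQuadPair α φ) (hp : IsParallel α φ d₁ d₂) {x y : X}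
    (hx : jointSetoid (cutInversion α d₁ d₂) φ d₂ x)
    (hy : jointSetoid (cutInversion α d₁ d₂) φ d₂ y) (hxy : (α * φ).SameCycle x y) :
    (cutInversion α d₁ d₂ * φ).SameCycle x y := by
  obtain ⟨hs, -⟩ := setoid_cutInversion h hp
  have hn := not_jointSetoid_cutInversion h hp
  have a1 := hp.ne_inv h
  have j1 := jointSetoid_left (cutInversion α d₁ d₂) φ d₁
  rw [cutInversion_apply_left h.ne a1] at j1
  have hr : ∀ {a b}, (cutInversion α d₁ d₂ * φ).SameCycle a b →
      jointSetoid (cutInversion α d₁ d₂) φ a b := fun k => jointSetoid_mul k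
  have hrσ : ∀ {a b}, (cutInversion α d₁ d₂ * φ).SameCycle a b → (α * φ).SameCycle a b :=
    fun k => hs.ge (Setoid.le_adjoin _ _ _ (Setoid.le_adjoin _ _ _ k))
  set J := jointSetoid (cutInversion α d₁ d₂) φ
  have not1 : ∀ {z}, J d₂ z → ¬ (cutInversion α d₁ d₂ * φ).SameCycle z d₁ :=
    fun hz k => hn (J.symm' (J.trans' hz (hr k)))
  have not2 : ∀ {z}, J d₂ z → ¬ (cutInversion α d₁ d₂ * φ).SameCycle z (α d₂) :=
    fun hz k => hn (J.trans' j1 (J.symm' (J.trans' hz (hr k))))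
  have l1 : ¬ (α * φ).SameCycle (α d₁) d₁ := fun k => h.not_sameCycle _ k.symm
  have key : ∀ {z}, J d₂ z → ((SameCycle.setoid (cutInversion α d₁ d₂ * φ)).adjoin d₁ d₂ z (α d₁) ∨
      (SameCycle.setoid (cutInversion α d₁ d₂ * φ)).adjoin d₁ d₂ z (α d₂)) →
      (cutInversion α d₁ d₂ * φ).SameCycle z (α d₁) := by
    rintro z hz ((k | ⟨-, k | k⟩) | (k | ⟨-, k | k⟩))
    · exact k
    · exact absurd (hrσ k) l1
    · exact absurd ((hrσ k).trans hp.start.symm) l1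
    · exact absurd k (not2 hz)
    · exact absurd (hp.target.trans (hrσ k)) l1
    · exact absurd ((hp.target.trans (hrσ k)).trans hp.start.symm) l1
  rcases hs.le hxy with (k | ⟨k | k, k' | k'⟩) | ⟨k, k'⟩
  · exact k
  · exact absurd k (not1 hx)
  · exact absurd k (not1 hx)
  · exact absurd k' (not1 hy)
  · exact SameCycle.trans k (SameCycle.symm k')
  · exact (key hx k).trans (key hy k').symm

/-- The start of `d` is on the side of `d₂` and is not an end of the new edge there, whose
directions are `d₂` and `α d₁`. Hence the cut does not change the rotation around it, and edges at
it that are parallel before the cut are parallel afterwards. It is not an end of `e`, which lies on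
the other side. -/
theorem isReducible_of_cutInversion (h : IsPlaneQuadPair α φ) (hp : IsParallel α φ d₁ d₂)
    (he : jointSetoid (cutInversion α d₁ d₂) φ e d₁)
    (hd : jointSetoid (cutInversion α d₁ d₂) φ d₂ d)
    (hd₂ : ¬ (cutInversion α d₁ d₂ * φ).SameCycle d d₂)
    (hd₁ : ¬ (cutInversion α d₁ d₂ * φ).SameCycle d (α d₁))
    (hred : IsReducible (cutInversion α d₁ d₂) φ d) :
    jointSetoid α φ e d ∧ ¬ (α * φ).SameCycle d e ∧ ¬ (α * φ).SameCycle d (α e) ∧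
      IsReducible α φ d := by
  have hle := jointSetoid_cutInversion_le h hp
  have hn := not_jointSetoid_cutInversion h hp
  have a1 := hp.ne_inv h
  have a2 := hp.symm.ne_inv h
  have j1 := jointSetoid_left (cutInversion α d₁ d₂) φ d₁
  rw [cutInversion_apply_left h.ne a1] at j1
  have hsep := fun {x y} => sameCycle_cutInversion (x := x) (y := y) h hp
  have hcut := fun z => cutInversion_apply_of_ne (α := α) (d₁ := d₁) (d₂ := d₂) (d := z) h.invol
  have jl := jointSetoid_left (cutInversion α d₁ d₂) φ
  have hmul : ∀ z, (α * φ) z =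
      swap (α d₁) (α d₂) (swap d₁ d₂ ((cutInversion α d₁ d₂ * φ) z)) := by
    intro z
    simp [cutInversion]
  have hr : ∀ {a b}, (cutInversion α d₁ d₂ * φ).SameCycle a b →
      jointSetoid (cutInversion α d₁ d₂) φ a b := fun k => jointSetoid_mul k
  set σ' := cutInversion α d₁ d₂ * φ with hσ'
  set J := jointSetoid (cutInversion α d₁ d₂) φ with hJ
  set S : Set X := {y | σ'.SameCycle d y} with hS
  have hSJ : ∀ y ∈ S, J d₂ y := fun y hy => J.trans' hd (hr hy)
  have s1 : d₁ ∉ S := fun k => hn (J.symm' (hSJ _ k))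
  have s2 : d₂ ∉ S := hd₂
  have s3 : α d₁ ∉ S := hd₁
  have s4 : α d₂ ∉ S := fun k => hn (J.trans' j1 (J.symm' (hSJ _ k)))
  have hSne : ∀ y ∈ S, y ≠ d₁ ∧ y ≠ d₂ ∧ y ≠ α d₁ ∧ y ≠ α d₂ := fun y hy =>
    ⟨fun k => s1 (k ▸ hy), fun k => s2 (k ▸ hy), fun k => s3 (k ▸ hy), fun k => s4 (k ▸ hy)⟩
  have hSσ' : ∀ y ∈ S, σ' y ∈ S := fun y hy => SameCycle.trans hy (setoid_apply_self σ' y)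
  have hσ : ∀ y ∈ S, (α * φ) y = σ' y := by
    intro y hy
    obtain ⟨k1, k2, k3, k4⟩ := hSne _ (hSσ' y hy)
    rw [hmul, swap_apply_of_ne_of_ne k1 k2, swap_apply_of_ne_of_ne k3 k4]
  have hdS : d ∈ S := SameCycle.refl _ _
  have hmem : ∀ y, (α * φ).SameCycle d y → y ∈ S := fun y hy =>
    hy.mem_of_mapsTo (fun z hz => by rw [hσ z hz]; exact hSσ' z hz) hdS
  have hJd₂ : ∀ y, (α * φ).SameCycle d y → ¬ J e y := fun y hy k =>
    hn (J.trans' (J.symm' he) (J.trans' k (J.symm' (hSJ y (hmem y hy)))))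
  refine ⟨?_, fun k => hJd₂ _ k (J.refl' e), fun k => ?_, ?_, ?_⟩
  · have t := fun {x y z} => (jointSetoid α φ).trans' (x := x) (y := y) (z := z)
    exact t (hle he) (t (jointSetoid_mul hp.start) (hle hd))
  · obtain ⟨k1, k2, k3, k4⟩ := hSne _ (hmem _ k)
    apply hJd₂ _ k
    have inv := h.invol
    rw [← hcut e (fun l => k3 (by rw [l])) (fun l => k4 (by rw [l]))
      (fun l => k1 (by rw [l, inv])) fun l => k2 (by rw [l, inv])]
    exact jl e
  · rw [hσ d hdS, hσ _ (hSσ' d hdS), hσ _ (hSσ' _ (hSσ' d hdS))]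
    exact hred.card
  · intro d' d'' hd' hd'' hpar
    have m' := hmem _ hd'
    have m'' := hmem _ hd''
    obtain ⟨k1, k2, k3, k4⟩ := hSne _ m'
    obtain ⟨l1, l2, l3, l4⟩ := hSne _ m''
    refine hred.simple d' d'' m' m'' ⟨hpar.ne, SameCycle.trans (SameCycle.symm m') m'', ?_⟩
    refine hsep (J.trans' (hSJ _ m') (jl _)) (J.trans' (hSJ _ m'') (jl _)) ?_
    rw [hcut d' k1 k2 k3 k4, hcut d'' l1 l2 l3 l4]
    exact hpar.target

theorem four_le_classCard {f : Perm X} (h1 : f d ≠ d) (h2 : f (f d) ≠ d) (h3 : f (f (f d)) ≠ d) :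
    4 ≤ (SameCycle.setoid f).classCard d := by
  have s := setoid_apply_self f
  have t := fun {x y z} => (SameCycle.setoid f).trans' (x := x) (y := y) (z := z)
  have hsub : (({d, f d, f (f d), f (f (f d))} : Finset X) : Set X) ⊆
      {y | SameCycle.setoid f d y} := by
    intro y hy
    simp only [Finset.coe_insert, Finset.coe_singleton, Set.mem_insert_iff,
      Set.mem_singleton_iff] at hy
    rcases hy with rfl | rfl | rfl | rfl
    · exact Setoid.refl' (SameCycle.setoid f) _
    · exact s d
    · exact t (s d) (s _)
    · exact t (t (s d) (s _)) (s _)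
  have := Set.ncard_le_ncard hsub (Set.toFinite _)
  rw [Set.ncard_coe_finset] at this
  have inj := f.injective
  rwa [Finset.card_insert_of_notMem, Finset.card_insert_of_notMem, Finset.card_pair] at this
  · exact fun k => h1 (inj (inj k.symm))
  · simp only [Finset.mem_insert, Finset.mem_singleton]
    rintro (k | k)
    · exact h1 (inj k.symm)
    · exact h2 (inj k.symm)
  · simp only [Finset.mem_insert, Finset.mem_singleton]
    rintro (k | k | k)
    · exact h1 k.symm
    · exact h2 k.symm
    · exact h3 k.symm

/-- A component of a plane quadrangulation has a vertex of degree at most 3 that is not an end of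
the given edge. -/
theorem IsPlaneQuadPair.exists_small_degree (h : IsPlaneQuadPair α φ) (e : X) :
    ∃ d, jointSetoid α φ e d ∧ ¬ (α * φ).SameCycle d e ∧ ¬ (α * φ).SameCycle d (α e) ∧
      ((α * φ) d = d ∨ (α * φ) ((α * φ) d) = d ∨ (α * φ) ((α * φ) ((α * φ) d)) = d) := by
  classical
  by_contra! hcon
  have := Fintype.ofFinite X
  have hsum := h.sum_component e
  set r := SameCycle.setoid (α * φ) with hr
  have hAB : _root_.Disjoint (Finset.univ.filter fun x => r e x)
      (Finset.univ.filter fun x => r (α e) x) := by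
    rw [Finset.disjoint_filter]
    exact fun x _ k k' => h.not_sameCycle e (SameCycle.trans k (SameCycle.symm k'))
  have hsub : (Finset.univ.filter fun x => r e x).disjUnion
      (Finset.univ.filter fun x => r (α e) x) hAB ⊆
      Finset.univ.filter fun x => jointSetoid α φ e x := by
    intro x hx
    simp only [Finset.mem_disjUnion, Finset.mem_filter, Finset.mem_univ, true_and] at hx ⊢
    rcases hx with k | k
    · exact jointSetoid_mul k
    · exact Setoid.trans' _ (jointSetoid_left α φ e) (jointSetoid_mul k)
  have hle : ∑ x with jointSetoid α φ e x, ((r.classCard x : ℚ)⁻¹ - 1 / 4) ≤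
      ∑ x ∈ (Finset.univ.filter fun x => r e x).disjUnion
        (Finset.univ.filter fun x => r (α e) x) hAB, ((r.classCard x : ℚ)⁻¹ - 1 / 4) := by
    rw [← Finset.sum_sdiff hsub]
    apply add_le_of_nonpos_left
    apply Finset.sum_nonpos
    intro x hx
    simp only [Finset.mem_sdiff, Finset.mem_disjUnion, Finset.mem_filter, Finset.mem_univ,
      true_and, not_or] at hx
    -- Away from the ends of `e` all degrees are at least 4, so these terms are not positive.
    obtain ⟨k1, k2, k3⟩ := hcon x hx.1 (fun k => hx.2.1 (SameCycle.symm k))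
      fun k => hx.2.2 (SameCycle.symm k)
    have h4 : (4 : ℚ) ≤ r.classCard x := by exact_mod_cast four_le_classCard k1 k2 k3
    have := inv_anti₀ (by norm_num) h4
    linarith
  -- A vertex of degree $k$ contributes $1-k/4$, so the two ends of `e` cannot reach the total of 2.
  have hlt : ∀ a, ∑ x with r a x, ((r.classCard x : ℚ)⁻¹ - 1 / 4) < 1 := by
    intro a
    rw [Finset.sum_sub_distrib, r.sum_class_inv_classCard a, Finset.sum_const, nsmul_eq_mul]
    have : 0 < (Finset.univ.filter fun x => r a x).card :=
      Finset.card_pos.2 ⟨a, by simp⟩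
    have : (0 : ℚ) < (Finset.univ.filter fun x => r a x).card := by exact_mod_cast this
    linarith
  rw [Finset.sum_disjUnion] at hle
  have := hlt e
  have := hlt (α e)
  linarith

/-- A component of a plane quadrangulation has a vertex of degree at most 3 that is not incident
with parallel edges and is not an end of the given edge. -/
theorem IsPlaneQuadPair.exists_isReducible (h : IsPlaneQuadPair α φ) (e : X) :
    ∃ d, jointSetoid α φ e d ∧ ¬ (α * φ).SameCycle d e ∧ ¬ (α * φ).SameCycle d (α e) ∧
      IsReducible α φ d := by
  induction hn : Nat.card X - (jointSetoid α φ).numClasses using Nat.strong_induction_on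
    generalizing α e with
  | _ n ih =>
    by_cases hpar : ∃ d₁ d₂, jointSetoid α φ e d₁ ∧ IsParallel α φ d₁ d₂
    · obtain ⟨d₁, d₂, hp, he⟩ :
          ∃ d₁ d₂, IsParallel α φ d₁ d₂ ∧ jointSetoid (Perm.cutInversion α d₁ d₂) φ e d₁ := by
        obtain ⟨d₁, d₂, he, hp⟩ := hpar
        rcases le_adjoin_jointSetoid_cutInversion h hp he with k | ⟨k | k, -⟩
        · exact ⟨d₁, d₂, hp, k⟩
        · exact ⟨d₁, d₂, hp, k⟩
        · exact ⟨d₂, d₁, hp.symm, by rwa [cutInversion_comm]⟩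
      have hc := numClasses_cutInversion h hp
      have hle := (jointSetoid (Perm.cutInversion α d₁ d₂) φ).numClasses_le_card
      -- The cut adds a component, so the measure drops; `hle` keeps the natural subtraction from
      -- being truncated. The edge to avoid is now the new edge on the far side.
      obtain ⟨d, h1, h2, h3, h4⟩ := ih _ (by omega) (h.cutInversion hp) d₂ rfl
      rw [cutInversion_apply_right h.ne (hp.symm.ne_inv h)] at h3
      exact ⟨d, isReducible_of_cutInversion h hp he h1 h2 h3 h4⟩
    · push Not at hpar
      obtain ⟨d, h1, h2, h3, h4⟩ := h.exists_small_degree e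
      exact ⟨d, h1, h2, h3, h4, fun d' d'' k _ =>
        hpar d' d'' (Setoid.trans' _ h1 (jointSetoid_mul k))⟩

end Equiv.Perm

/-! ### From maps to pairs of permutations -/

namespace Equiv.Perm

variable {X : Type*} [Finite X] {f : Perm X} {x : X}

theorem apply_mem_iff {S : Set X} (hS : ∀ z ∈ S, f z ∈ S) : f x ∈ S ↔ x ∈ S :=
  ⟨fun h => SameCycle.mem_of_mapsTo (SameCycle.symm (setoid_apply_self f x)) hS h, hS x⟩

theorem classCard_eq_one (h : f x = x) : (SameCycle.setoid f).classCard x = 1 := by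
  rw [Setoid.classCard, Set.ncard_eq_one]
  refine ⟨x, Set.eq_singleton_iff_unique_mem.2 ⟨Setoid.refl' (SameCycle.setoid f) x, fun y hy => ?_⟩⟩
  refine SameCycle.mem_of_mapsTo (f := f) (S := {x}) hy ?_ rfl
  rintro z rfl
  exact h

theorem classCard_eq_two (h : f (f x) = x) (hne : f x ≠ x) :
    (SameCycle.setoid f).classCard x = 2 := by
  rw [Setoid.classCard, Set.ncard_eq_two]
  refine ⟨x, f x, hne.symm, Set.ext fun y => ⟨fun hy => ?_, ?_⟩⟩
  · refine SameCycle.mem_of_mapsTo (f := f) hy ?_ (by simp)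
    rintro z (rfl | rfl)
    · simp
    · rw [h]; simp
  · rintro (rfl | rfl)
    · exact Setoid.refl' (SameCycle.setoid f) _
    · exact setoid_apply_self f x

/-- The cycle length divides 4 but not 2, so it is 4. This makes the quadrangulation condition
pointwise. -/
theorem classCard_eq_four_iff :
    (SameCycle.setoid f).classCard x = 4 ↔ f (f (f (f x))) = x ∧ f (f x) ≠ x := by
  classical
  refine ⟨fun h => ?_, fun h => ncard_face h.1 h.2⟩
  have := Fintype.ofFinite X
  have h1 : f x ≠ x := fun k => by rw [classCard_eq_one k] at h; omega
  have h2 : f (f x) ≠ x := fun k => by rw [classCard_eq_two k h1] at h; omega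
  refine ⟨?_, h2⟩
  have hc := (isCycle_cycleOf f h1).orderOf
  have hs : (f.cycleOf x).support.card = 4 := by
    rw [← h, Setoid.classCard, ← Set.ncard_coe_finset]
    congr 1
    ext y
    rw [Finset.mem_coe, mem_support_cycleOf_iff, mem_support]
    exact and_iff_left h1
  have := cycleOf_pow_apply_self f x 4
  rw [← hs, ← hc, pow_orderOf_eq_one, hc, hs] at this
  exact this.symm

end Equiv.Perm

theorem Setoid.mul_numClasses_of_classCard {X : Type*} [Finite X] {r : Setoid X} {k : ℕ}
    (h : ∀ x, r.classCard x = k) (hk : k ≠ 0) : k * r.numClasses = Nat.card X := by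
  have := Fintype.ofFinite X
  have e := r.numClasses_eq_sum
  simp only [h, Finset.sum_const, nsmul_eq_mul, Finset.card_univ] at e
  have hk' : (k : ℚ) ≠ 0 := by exact_mod_cast hk
  rw [Nat.card_eq_fintype_card]
  have : (k : ℚ) * r.numClasses = Fintype.card X := by rw [e]; field_simp
  exact_mod_cast this

namespace OrientedMap

variable {V : Type u} {D : Type v} {M : OrientedMap V D}

/-- The permutation whose cycles are the faces. -/
def facePerm (M : OrientedMap V D) : Perm D := M.rev * M.rot

theorem rev_mul_facePerm (M : OrientedMap V D) : M.rev * M.facePerm = M.rot :=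
  Equiv.ext fun d => M.rev_rev (M.rot d)

theorem exists_start_eq (M : OrientedMap V D) (d : D) (x : V) : ∃ e, M.start e = x := by
  rcases Relation.ReflTransGen.cases_tail (M.connected (M.start d) x) with h | ⟨y, -, e, -, h⟩
  · exact ⟨d, h.symm⟩
  · exact ⟨_, h⟩

variable [Finite D]

/-- Connectedness as an induction principle on directed edges. -/
theorem mem_of_mapsTo_rot_rev {S : Set D} {d : D} (hd : d ∈ S) (hrot : ∀ z ∈ S, M.rot z ∈ S)
    (hrev : ∀ z ∈ S, M.rev z ∈ S) (z : D) : z ∈ S := by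
  have key : ∀ y, Relation.ReflTransGen
      (fun s t => ∃ d, M.start d = s ∧ M.start (M.rev d) = t) (M.start d) y →
      ∀ z, M.start z = y → z ∈ S := by
    intro y hy
    induction hy with
    | refl => exact fun z hz => (M.sameCycle_rot d z hz.symm).mem_of_mapsTo hrot hd
    | tail _ h ih =>
      obtain ⟨e, he, he'⟩ := h
      exact fun z hz => (M.sameCycle_rot _ z (he'.trans hz.symm)).mem_of_mapsTo hrot (hrev e (ih e he))
  exact key _ (M.connected _ _) z rfl

theorem start_eq_iff {d e : D} : M.start d = M.start e ↔ M.rot.SameCycle d e := by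
  refine ⟨M.sameCycle_rot d e, fun h => ?_⟩
  exact h.mem_of_mapsTo (S := {z | M.start d = M.start z})
    (fun z hz => Eq.trans hz (M.start_rot z).symm) rfl

/-- An isolated vertex would have no cycle; connectedness excludes it once there is an edge. -/
theorem numCycles_rot (M : OrientedMap V D) [Nonempty D] : M.rot.numCycles = Nat.card V := by
  refine Nat.card_congr (Equiv.ofBijective
    (Quotient.lift M.start fun a b h => start_eq_iff.2 h) ⟨?_, ?_⟩)
  · intro a b h
    induction a using Quotient.inductionOn with | _ a
    induction b using Quotient.inductionOn with | _ b
    exact Quotient.sound (s := SameCycle.setoid M.rot) (start_eq_iff.1 h)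
  · intro x
    obtain ⟨e, he⟩ := M.exists_start_eq (Classical.arbitrary D) x
    exact ⟨Quotient.mk _ e, he⟩

theorem two_mul_card_edge (M : OrientedMap V D) : 2 * Nat.card M.Edge = Nat.card D :=
  Setoid.mul_numClasses_of_classCard
    (fun d => classCard_eq_two (M.rev_rev d) (M.rev_ne d)) (by norm_num)

theorem isQuadrangulation_iff : M.IsQuadrangulation ↔
    ∀ d, M.facePerm (M.facePerm (M.facePerm (M.facePerm d))) = d ∧
      M.facePerm (M.facePerm d) ≠ d := by
  have hc : ∀ d, M.faceSize (M.faceOf d) = (SameCycle.setoid M.facePerm).classCard d := by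
    intro d
    rw [faceSize, Setoid.classCard, ← Nat.card_coe_set_eq]
    refine Nat.card_congr (Equiv.subtypeEquivRight fun y => ?_)
    exact ⟨fun h => Setoid.symm' (SameCycle.setoid M.facePerm) (Quotient.exact h),
      fun h => Quotient.sound (s := SameCycle.setoid M.facePerm) (SameCycle.symm h)⟩
  constructor
  · intro h d
    rw [← classCard_eq_four_iff, ← hc]
    exact h _
  · intro h F
    induction F using Quotient.inductionOn with | _ d
    exact (hc d).trans (classCard_eq_four_iff.2 (h d))

theorem IsQuadrangulation.four_mul_card_face (h : M.IsQuadrangulation) :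
    4 * Nat.card M.Face = Nat.card D :=
  Setoid.mul_numClasses_of_classCard
    (fun d => classCard_eq_four_iff.2 (isQuadrangulation_iff.1 h d)) (by norm_num)

theorem IsQuadrangulation.isPlane_iff (h : M.IsQuadrangulation) :
    M.IsPlane ↔ 4 * Nat.card V = Nat.card D + 8 := by
  have h1 : (2 : ℚ) * Nat.card M.Edge = Nat.card D := by exact_mod_cast M.two_mul_card_edge
  have h2 : (4 : ℚ) * Nat.card M.Face = Nat.card D := by exact_mod_cast h.four_mul_card_face
  rw [IsPlane, genus]
  constructor
  · intro k
    have : (4 : ℚ) * Nat.card V = Nat.card D + 8 := by linarith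
    exact_mod_cast this
  · intro k
    have : (4 : ℚ) * Nat.card V = Nat.card D + 8 := by exact_mod_cast k
    linarith

/-- Without edges there is at most one vertex, but the count would require two. -/
theorem IsQuadrangulation.nonempty_dart (h : M.IsQuadrangulation) (hp : M.IsPlane) :
    Nonempty D := by
  by_contra hD
  rw [not_nonempty_iff] at hD
  have : Subsingleton V := by
    refine ⟨fun x y => ?_⟩
    rcases Relation.ReflTransGen.cases_tail (M.connected x y) with k | ⟨_, -, d, -⟩
    · exact k.symm
    · exact hD.elim d
  have hV : Nat.card V ≤ 1 := Finite.card_le_one_iff_subsingleton.2 this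
  have := h.isPlane_iff.1 hp
  rw [Nat.card_of_isEmpty (α := D)] at this
  omega

theorem numClasses_jointSetoid (M : OrientedMap V D) [Nonempty D] :
    (jointSetoid M.rev M.facePerm).numClasses = 1 := by
  rw [Setoid.numClasses, Nat.card_eq_one_iff_unique]
  refine ⟨Quotient.subsingleton_iff.2 (Setoid.eq_top_iff.2 fun d z => ?_),
    ⟨Quotient.mk _ (Classical.arbitrary D)⟩⟩
  have t := fun {x y z} => (jointSetoid M.rev M.facePerm).trans' (x := x) (y := y) (z := z)
  refine M.mem_of_mapsTo_rot_rev (S := {z | jointSetoid M.rev M.facePerm d z})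
    (Setoid.refl' (jointSetoid M.rev M.facePerm) d) (fun z hz => ?_) (fun z hz => ?_) z
  · refine t hz (jointSetoid_mul ?_)
    rw [rev_mul_facePerm]
    exact setoid_apply_self M.rot z
  · exact t hz (jointSetoid_left _ _ z)

theorem IsQuadrangulation.isPlaneQuadPair (h : M.IsQuadrangulation) (hp : M.IsPlane) :
    IsPlaneQuadPair M.rev M.facePerm := by
  have := h.nonempty_dart hp
  refine ⟨M.rev_rev, M.rev_ne, fun d => (isQuadrangulation_iff.1 h d).1,
    fun d => (isQuadrangulation_iff.1 h d).2, ?_⟩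
  have h1 : 2 * M.rev.numCycles = Nat.card D := M.two_mul_card_edge
  have h2 : 4 * M.facePerm.numCycles = Nat.card D := h.four_mul_card_face
  have h3 := h.isPlane_iff.1 hp
  rw [IsPlanarPair, excess, numClasses_jointSetoid, rev_mul_facePerm, numCycles_rot]
  omega

theorem IsQuadrangulation.start_ne_target (h : M.IsQuadrangulation) (hp : M.IsPlane) (d : D) :
    M.start d ≠ M.start (M.rev d) := by
  rw [Ne, start_eq_iff, ← rev_mul_facePerm]
  exact (h.isPlaneQuadPair hp).not_sameCycle d

/-- The prescribed edge `e` is arbitrary here; avoiding it matters only in the induction over cuts.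
-/
theorem IsQuadrangulation.exists_reducible (h : M.IsQuadrangulation) (hp : M.IsPlane) :
    ∃ m, (M.rot m = m ∨ M.rot (M.rot m) = m ∨ M.rot (M.rot (M.rot m)) = m) ∧
      ∀ d e, M.start d = M.start m → M.start e = M.start m →
        M.start (M.rev d) = M.start (M.rev e) → d = e := by
  classical
  obtain ⟨e⟩ := h.nonempty_dart hp
  obtain ⟨m, -, -, -, hm⟩ := (h.isPlaneQuadPair hp).exists_isReducible e
  have hc := hm.card
  have hs := hm.simple
  rw [rev_mul_facePerm] at hc hs
  refine ⟨m, hc, fun d d' hd hd' ht => by_contra fun hne => ?_⟩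
  refine hs d d' (start_eq_iff.1 hd.symm) (start_eq_iff.1 hd'.symm) ⟨hne, ?_, ?_⟩
  · rw [rev_mul_facePerm]; exact start_eq_iff.1 (hd.trans hd'.symm)
  · rw [rev_mul_facePerm]; exact start_eq_iff.1 ht

/-- The four directed edges are closed under rotation and inversion, so by connectedness there are
no others. -/
theorem isPath3_of_rot {d e : D} (hloop : ∀ z, M.start z ≠ M.start (M.rev z)) (hne : d ≠ e)
    (hd : M.rot d = e) (he : M.rot e = d) (hd' : M.rot (M.rev d) = M.rev d)
    (he' : M.rot (M.rev e) = M.rev e) : M.IsPath3 := by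
  have hs : M.start d = M.start e := by rw [← hd, M.start_rot]
  have hall : ∀ z, z ∈ [d, M.rev d, e, M.rev e] := by
    refine M.mem_of_mapsTo_rot_rev (d := d) (S := {z | z ∈ [d, M.rev d, e, M.rev e]}) (by simp) ?_ ?_
    · intro z hz
      simp only [List.mem_cons, List.not_mem_nil, or_false, Set.mem_ofPred_eq] at hz
      rcases hz with rfl | rfl | rfl | rfl
      · simp [hd]
      · simp [hd']
      · simp [he]
      · simp [he']
    · intro z hz
      simp only [List.mem_cons, List.not_mem_nil, or_false, Set.mem_ofPred_eq] at hz
      rcases hz with rfl | rfl | rfl | rfl <;> simp [M.rev_rev]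
  have hne' : M.start (M.rev d) ≠ M.start (M.rev e) := by
    intro k
    have : M.rev e ∈ ({M.rev d} : Set D) := by
      refine (start_eq_iff.1 k).mem_of_mapsTo ?_ rfl
      rintro z rfl
      exact hd'
    exact hne (M.rev.injective this).symm
  refine ⟨d, e, hs, ?_, fun x => ?_, hall⟩
  · simp only [target, List.nodup_cons, List.mem_cons, List.not_mem_nil, or_false, not_or,
      List.nodup_nil, and_true, not_false_eq_true]
    exact ⟨⟨(hloop d).symm, hne'⟩, hs ▸ hloop e⟩
  · obtain ⟨z, rfl⟩ := M.exists_start_eq d x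
    have := hall z
    simp only [target, List.mem_cons, List.not_mem_nil, or_false] at this ⊢
    rcases this with rfl | rfl | rfl | rfl
    · exact Or.inr (Or.inl rfl)
    · exact Or.inl rfl
    · exact Or.inr (Or.inl hs.symm)
    · exact Or.inr (Or.inr rfl)

end OrientedMap

/-! ### Merging one vertex into another -/

namespace OrientedMap

variable {V : Type u} {D : Type v} {M : OrientedMap V D}

/-- The data for merging the vertex `w` into the vertex `x`: the directed edges in `keep` survive,
`rot` is the new rotation, and `proj` sends every directed edge to the one it is identified with.
The new face permutation is conjugate to the old one. -/
structure Contraction (M : OrientedMap V D) where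
  /-- the vertex that vanishes -/
  w : V
  /-- the vertex into which it is merged -/
  x : V
  /-- the directed edges that survive -/
  keep : Set D
  /-- the new rotation -/
  rot : Perm D
  /-- the identification of directed edges -/
  proj : D → D
  ne : x ≠ w
  rev_mem : ∀ d, M.rev d ∈ keep ↔ d ∈ keep
  rot_mem : ∀ d, rot d ∈ keep ↔ d ∈ keep
  proj_mem : ∀ d, proj d ∈ keep
  proj_of_mem : ∀ d ∈ keep, proj d = d
  proj_rev : ∀ d, proj (M.rev d) = M.rev (proj d)
  sameCycle_proj : ∀ d, rot.SameCycle (proj d) (proj (M.rot d))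
  start_proj : ∀ d, M.start (proj d) = M.start d ∨ M.start d = w ∧ M.start (proj d) = x
  start_rot : ∀ d, M.start (rot d) = M.start d ∨
    (M.start d = w ∨ M.start d = x) ∧ (M.start (rot d) = w ∨ M.start (rot d) = x)
  bridge : ∃ m, M.start m = w ∧ M.start (proj m) = x
  conj : ∃ ψ : Perm D, M.rev * rot = ψ * M.facePerm * ψ⁻¹

namespace Contraction

open Classical in
/-- The map on vertices that merges `w` into `x`. -/
noncomputable def merge (C : M.Contraction) (v : V) : {v : V // v ≠ C.w} :=
  if h : v = C.w then ⟨C.x, C.ne⟩ else ⟨v, h⟩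

variable (C : M.Contraction)

theorem merge_w : C.merge C.w = ⟨C.x, C.ne⟩ := dif_pos rfl

theorem merge_of_ne {v : V} (h : v ≠ C.w) : C.merge v = ⟨v, h⟩ := dif_neg h

theorem merge_x : C.merge C.x = ⟨C.x, C.ne⟩ := C.merge_of_ne C.ne

theorem merge_start_proj (d : D) : C.merge (M.start (C.proj d)) = C.merge (M.start d) := by
  rcases C.start_proj d with h | ⟨h, h'⟩
  · rw [h]
  · rw [h, h', merge_w, merge_x]

theorem merge_start_rot (d : D) : C.merge (M.start (C.rot d)) = C.merge (M.start d) := by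
  rcases C.start_rot d with h | ⟨h | h, h' | h'⟩
  · rw [h]
  · rw [h, h']
  · rw [h, h', merge_w, merge_x]
  · rw [h, h', merge_w, merge_x]
  · rw [h, h']

theorem eq_of_merge_eq {a b : V} (h : C.merge a = C.merge b) :
    a = b ∨ (a = C.w ∧ b = C.x) ∨ (a = C.x ∧ b = C.w) := by
  by_cases ha : a = C.w <;> by_cases hb : b = C.w
  · exact Or.inl (ha.trans hb.symm)
  · rw [ha, merge_w, C.merge_of_ne hb, Subtype.mk.injEq] at h
    exact Or.inr (Or.inl ⟨ha, h.symm⟩)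
  · rw [hb, merge_w, C.merge_of_ne ha, Subtype.mk.injEq] at h
    exact Or.inr (Or.inr ⟨h, hb⟩)
  · rw [C.merge_of_ne ha, C.merge_of_ne hb, Subtype.mk.injEq] at h
    exact Or.inl h

variable [Finite D]

theorem sameCycle_proj_of_start_eq {d e : D} (h : M.start d = M.start e) :
    C.rot.SameCycle (C.proj d) (C.proj e) :=
  SameCycle.mem_of_mapsTo (S := {z | C.rot.SameCycle (C.proj d) (C.proj z)}) (start_eq_iff.1 h)
    (fun z hz => SameCycle.trans hz (C.sameCycle_proj z)) (SameCycle.refl _ _)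

/-- Directed edges at one old vertex project into one new cycle; the bridge, a directed edge at `w`
that projects to one at `x`, links the cycle of `w` to that of `x`. -/
theorem sameCycle_of_merge_eq {d e : D} (hd : d ∈ C.keep) (he : e ∈ C.keep)
    (h : C.merge (M.start d) = C.merge (M.start e)) : C.rot.SameCycle d e := by
  obtain ⟨m, hm, hm'⟩ := C.bridge
  have key : ∀ {d e : D}, d ∈ C.keep → e ∈ C.keep → M.start d = C.w → M.start e = C.x →
      C.rot.SameCycle d e := by
    intro d e hd he h h'
    have h1 := C.sameCycle_proj_of_start_eq (h.trans hm.symm)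
    have h2 := C.sameCycle_proj_of_start_eq (hm'.trans h'.symm)
    rw [C.proj_of_mem _ (C.proj_mem m), C.proj_of_mem e he] at h2
    rw [C.proj_of_mem d hd] at h1
    exact h1.trans h2
  rcases C.eq_of_merge_eq h with h | ⟨h, h'⟩ | ⟨h, h'⟩
  · have := C.sameCycle_proj_of_start_eq h
    rwa [C.proj_of_mem d hd, C.proj_of_mem e he] at this
  · exact key hd he h h'
  · exact (key he hd h' h).symm

/-- The map that arises by merging `w` into `x`. -/
noncomputable def map : OrientedMap {v : V // v ≠ C.w} {d : D // d ∈ C.keep} where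
  start d := C.merge (M.start d)
  rev := M.rev.subtypePerm C.rev_mem
  rot := C.rot.subtypePerm C.rot_mem
  rev_rev d := Subtype.ext (M.rev_rev d)
  rev_ne d h := M.rev_ne d (congrArg Subtype.val h)
  start_rot d := C.merge_start_rot d
  sameCycle_rot d e h := sameCycle_subtypePerm.2 (C.sameCycle_of_merge_eq d.2 e.2 h)
  nonempty := ⟨⟨C.x, C.ne⟩⟩
  connected x y := by
    have := (M.connected x y).lift C.merge (p := fun s t => ∃ d : {d : D // d ∈ C.keep},
      C.merge (M.start d) = s ∧ C.merge (M.start (M.rev d)) = t) ?_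
    · rwa [Function.onFun, C.merge_of_ne x.2, C.merge_of_ne y.2] at this
    · rintro _ _ ⟨d, rfl, rfl⟩
      refine ⟨⟨C.proj d, C.proj_mem d⟩, C.merge_start_proj d, ?_⟩
      rw [← C.proj_rev, C.merge_start_proj]

theorem map_start_of_ne {d : {d : D // d ∈ C.keep}} (h : M.start d ≠ C.w) :
    C.map.start d = ⟨M.start d, h⟩ := C.merge_of_ne h

theorem map_start_of_eq {d : {d : D // d ∈ C.keep}} (h : M.start d = C.w) :
    C.map.start d = ⟨C.x, C.ne⟩ := (congrArg C.merge h).trans C.merge_w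

/-- The new face permutation is the restriction of a conjugate of the old one, so its cycles still
have length 4. -/
theorem isQuadrangulation_map (h : M.IsQuadrangulation) : C.map.IsQuadrangulation := by
  rw [isQuadrangulation_iff] at h ⊢
  obtain ⟨ψ, hψ⟩ := C.conj
  have hval : ∀ d : {d : D // d ∈ C.keep}, (C.map.facePerm d : D) = ψ (M.facePerm (ψ.symm d)) :=
    fun d => Equiv.congr_fun hψ d
  intro d
  have h2 : (C.map.facePerm (C.map.facePerm d) : D) = ψ (M.facePerm (M.facePerm (ψ.symm d))) := by
    rw [hval, hval, symm_apply_apply]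
  refine ⟨Subtype.ext ?_, fun k => ?_⟩
  · rw [hval, hval, h2, symm_apply_apply, symm_apply_apply, (h _).1, apply_symm_apply]
  · have := congrArg Subtype.val k
    rw [h2] at this
    apply (h (ψ.symm d)).2
    apply ψ.injective
    rw [this, apply_symm_apply]

/-- Merging two vertices across a face removes one vertex and two edges. -/
theorem card_keep {a b : D} (hk : ∀ d, d ∈ C.keep ↔ d ∉ [a, M.rev a, b, M.rev b])
    (hn : [a, M.rev a, b, M.rev b].Nodup) :
    Nat.card {d : D // d ∈ C.keep} + 4 = Nat.card D := by
  classical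
  have e : C.keepᶜ = (([a, M.rev a, b, M.rev b].toFinset : Finset D) : Set D) := by
    ext d
    rw [Set.mem_compl_iff, hk, not_not]
    simp
  have := Set.ncard_add_ncard_compl C.keep
  rwa [e, Set.ncard_coe_finset, List.toFinset_card_of_nodup hn] at this

theorem isPlane_map (h : M.IsQuadrangulation) (hp : M.IsPlane)
    (hc : Nat.card {d : D // d ∈ C.keep} + 4 = Nat.card D) : C.map.IsPlane := by
  have h1 := h.isPlane_iff.1 hp
  rw [(C.isQuadrangulation_map h).isPlane_iff]
  -- `Nat.card` of an infinite type is 0, which the vertex count excludes.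
  have : Finite V := Nat.finite_of_card_ne_zero (by omega)
  have h2 : Nat.card {v : V // v ≠ C.w} + 1 = Nat.card V := by
    classical
    rw [← Finite.card_option]
    exact Nat.card_congr (Equiv.optionSubtypeNe C.w)
  omega

theorem addsVertexAndTwoEdges {a b : D} (hk : ∀ d, d ∈ C.keep ↔ d ∉ [a, M.rev a, b, M.rev b])
    (hn : [a, M.rev a, b, M.rev b].Nodup) :
    AddsVertexAndTwoEdges C.map M (Function.Embedding.subtype _) (Function.Embedding.subtype _)
      C.w a b where
  compl_range_vertex := by ext v; simp
  compl_range_dart := by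
    ext d
    have := hk d
    simp only [List.mem_cons, List.not_mem_nil, or_false] at this
    simp [this]
    tauto
  nodup := hn
  rev_old _ := rfl

end Contraction

end OrientedMap

/-! ### Folding a face at a vertex of degree 2 or 3 -/

namespace OrientedMap

variable {V : Type u} {D : Type v} {M : OrientedMap V D} {m n p r : D}

/-- The directed edges `m`, `n` start in a vertex `w` of degree 2 or 3 and `p`, `r` start in
another vertex `x`; the face at the angle between `n` and `m` is also the face at the angle between
`p` and `r`, and its four vertices are distinct. -/
structure IsFoldFace (M : OrientedMap V D) (m n p r : D) : Prop where
  rot_n : M.rot n = m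
  rot_rev_m : M.rot (M.rev m) = M.rev p
  rot_p : M.rot p = r
  rot_rev_r : M.rot (M.rev r) = M.rev n
  short : M.rot m = n ∨ M.rot (M.rot m) = n
  ne_mp : M.start m ≠ M.start p
  ne_ma : M.start m ≠ M.start (M.rev m)
  ne_mb : M.start m ≠ M.start (M.rev n)
  ne_pa : M.start p ≠ M.start (M.rev m)
  ne_pb : M.start p ≠ M.start (M.rev n)
  ne_ab : M.start (M.rev m) ≠ M.start (M.rev n)

namespace IsFoldFace

theorem start_n (h : M.IsFoldFace m n p r) : M.start n = M.start m := by
  rw [← h.rot_n, M.start_rot]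

theorem start_r (h : M.IsFoldFace m n p r) : M.start r = M.start p := by
  rw [← h.rot_p, M.start_rot]

theorem start_rev_p (h : M.IsFoldFace m n p r) : M.start (M.rev p) = M.start (M.rev m) := by
  rw [← h.rot_rev_m, M.start_rot]

theorem start_rev_r (h : M.IsFoldFace m n p r) : M.start (M.rev r) = M.start (M.rev n) := by
  rw [← h.rot_rev_r, M.start_rot]

open Classical in
/-- The rotation after identifying the edges of `m` and `p`, and those of `n` and `r`. -/
noncomputable def rot (M : OrientedMap V D) (m n p r : D) : Perm D :=
  swap (M.rev m) (M.rev p) * swap n r * M.rot * (swap (M.rev n) (M.rev r) * swap m p)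

theorem rev_m_ne_rev_p (h : M.IsFoldFace m n p r) : M.rev m ≠ M.rev p :=
  fun k => h.ne_mp (congrArg M.start (M.rev.injective k))

theorem rev_n_ne_rev_r (h : M.IsFoldFace m n p r) : M.rev n ≠ M.rev r :=
  fun k => h.ne_mp (h.start_n ▸ h.start_r ▸ congrArg M.start (M.rev.injective k))

theorem m_ne_n (h : M.IsFoldFace m n p r) : m ≠ n := fun k => h.ne_ab (k ▸ rfl)

theorem p_ne_r (h : M.IsFoldFace m n p r) : p ≠ r := fun k =>
  h.ne_ab (h.start_rev_p ▸ h.start_rev_r ▸ k ▸ rfl)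

-- On the discarded edges the new rotation is that of a separate path with 3 vertices, so the
-- surviving ones are closed under it. The clause for `p` inserts the third edge of `w` between `p`
-- and `r` when `w` has degree 3.
open Classical in
theorem rot_apply (h : M.IsFoldFace m n p r) (z : D) :
    rot M m n p r z = if z = m then n else if z = n then m else if z = M.rev m then M.rev m
      else if z = M.rev n then M.rev n else if z = M.rev r then M.rot (M.rev n)
      else if M.rot z = M.rev m then M.rev p else if z = p ∧ M.rot m ≠ n then M.rot m
      else if M.rot z = n then r else M.rot z := by
  have := h.start_n; have := h.start_r; have := h.start_rev_p; have := h.start_rev_r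
  have := M.start_rot z; have := M.start_rot m; have := M.start_rot (M.rev n)
  have := h.rev_m_ne_rev_p; have := h.rev_n_ne_rev_r; have := h.m_ne_n; have := h.p_ne_r
  have i1 : M.rot z = M.rot (M.rev m) → z = M.rev m := fun k => M.rot.injective k
  have i2 : M.rot z = M.rot p → z = p := fun k => M.rot.injective k
  have i3 : M.rot z = M.rot m → z = m := fun k => M.rot.injective k
  have i4 : M.rot (M.rev n) = M.rot (M.rev r) → M.rev n = M.rev r := fun k => M.rot.injective k
  simp only [rot, mul_apply]
  obtain ⟨h1, h2, h3, h4, h5, h6, h7, h8, h9, h10, h11⟩ := h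
  by_cases z1 : z = m
  · subst z1; simp only [swap_apply_left, if_true]; grind
  by_cases z2 : z = n
  · grind
  by_cases z3 : z = M.rev m
  · grind
  by_cases z4 : z = M.rev n
  · grind
  by_cases z5 : z = M.rev r
  · grind
  by_cases z6 : z = p
  · grind
  have z7 : (swap m p) z = z := swap_apply_of_ne_of_ne z1 z6
  have z8 : (swap (M.rev n) (M.rev r)) z = z := swap_apply_of_ne_of_ne z4 z5
  rw [z7, z8]
  grind

/-- The identification of `m` with `p` and of `n` with `r`. -/
noncomputable def proj (M : OrientedMap V D) (m n p r z : D) : D :=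
  open Classical in
  if z = m then p else if z = M.rev m then M.rev p else if z = n then r
    else if z = M.rev n then M.rev r else z

/-- The conjugating permutation carries the folded face `n, rev m, p, rev r` onto the four discarded
directed edges, so the surviving ones carry exactly the other faces. -/
theorem rev_mul_rot :
    ∃ ψ : Perm D, M.rev * rot M m n p r = ψ * M.facePerm * ψ⁻¹ := by
  classical
  refine ⟨swap m p * swap (M.rev n) (M.rev r), ?_⟩
  rw [mul_inv_rev, swap_inv, swap_inv, facePerm, rot]
  have e : ∀ a b, M.rev * swap (M.rev a) (M.rev b) = swap a b * M.rev := fun a b => by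
    rw [mul_swap_eq_swap_mul, M.rev_rev, M.rev_rev]
  have e' : M.rev * swap n r = swap (M.rev n) (M.rev r) * M.rev := mul_swap_eq_swap_mul ..
  have e'' : M.rev * (swap (M.rev m) (M.rev p) * swap n r) =
      swap m p * swap (M.rev n) (M.rev r) * M.rev := by
    rw [← mul_assoc, e, mul_assoc, e', mul_assoc]
  rw [← mul_assoc, ← mul_assoc M.rev, e'']
  simp only [mul_assoc]

theorem rot_apply_p (h : M.IsFoldFace m n p r) (hd : M.rot m = n) : rot M m n p r p = r := by
  have := h.start_n; have := h.start_r; have := h.start_rev_p; have := h.start_rev_r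
  have := h.rev_m_ne_rev_p; have := h.rev_n_ne_rev_r; have := h.m_ne_n; have := h.p_ne_r
  rw [h.rot_apply]
  obtain ⟨h1, h2, h3, h4, h5, h6, h7, h8, h9, h10, h11⟩ := h
  grind

theorem rot_apply_p' (h : M.IsFoldFace m n p r) (hd : M.rot m ≠ n) :
    rot M m n p r p = M.rot m := by
  have := h.start_n; have := h.start_r; have := h.start_rev_p; have := h.start_rev_r
  have := h.rev_m_ne_rev_p; have := h.rev_n_ne_rev_r; have := h.m_ne_n; have := h.p_ne_r
  rw [h.rot_apply]
  obtain ⟨h1, h2, h3, h4, h5, h6, h7, h8, h9, h10, h11⟩ := h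
  grind

theorem rot_apply_rot (h : M.IsFoldFace m n p r) (hd : M.rot m ≠ n) :
    rot M m n p r (M.rot m) = r := by
  have := h.start_n; have := h.start_r; have := h.start_rev_p; have := h.start_rev_r
  have := h.rev_m_ne_rev_p; have := h.rev_n_ne_rev_r; have := h.m_ne_n; have := h.p_ne_r
  have := M.start_rot m
  have i1 : M.rot m = M.rot n → m = n := fun k => M.rot.injective k
  rw [h.rot_apply]
  obtain ⟨h1, h2, h3, h4, h5, h6, h7, h8, h9, h10, h11⟩ := h
  grind

theorem rot_apply_rev_r (h : M.IsFoldFace m n p r) :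
    rot M m n p r (M.rev r) = M.rot (M.rev n) := by
  have := h.start_n; have := h.start_r; have := h.start_rev_p; have := h.start_rev_r
  have := h.rev_m_ne_rev_p; have := h.rev_n_ne_rev_r; have := h.m_ne_n; have := h.p_ne_r
  rw [h.rot_apply]
  obtain ⟨h1, h2, h3, h4, h5, h6, h7, h8, h9, h10, h11⟩ := h
  grind

theorem rot_apply_of_rot_eq_rev_m (h : M.IsFoldFace m n p r) {z : D} (hz : M.rot z = M.rev m) :
    rot M m n p r z = M.rev p := by
  have := h.start_n; have := h.start_r; have := h.start_rev_p; have := h.start_rev_r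
  have := h.rev_m_ne_rev_p; have := h.rev_n_ne_rev_r; have := h.m_ne_n; have := h.p_ne_r
  have := M.start_rot z
  rw [h.rot_apply]
  obtain ⟨h1, h2, h3, h4, h5, h6, h7, h8, h9, h10, h11⟩ := h
  grind

theorem rot_eq_rev_p_iff (h : M.IsFoldFace m n p r) {z : D} :
    rot M m n p r z = M.rev p ↔ M.rot z = M.rev m := by
  refine ⟨fun hz => ?_, h.rot_apply_of_rot_eq_rev_m⟩
  have e := h.rot_apply_of_rot_eq_rev_m (z := M.rot.symm (M.rev m)) (apply_symm_apply _ _)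
  rw [(rot M m n p r).injective (hz.trans e.symm), apply_symm_apply]

theorem rot_apply_of_ne (h : M.IsFoldFace m n p r) {z : D} (hz : z ∉ [m, M.rev m, n, M.rev n])
    (h1 : z ≠ p) (h2 : z ≠ M.rev r) (h3 : M.rot z ≠ M.rev m) (h4 : M.rot z ≠ n) :
    rot M m n p r z = M.rot z := by
  simp only [List.mem_cons, List.not_mem_nil, or_false, not_or] at hz
  rw [h.rot_apply, if_neg hz.1, if_neg hz.2.2.1, if_neg hz.2.1, if_neg hz.2.2.2, if_neg h2,
    if_neg h3, if_neg fun k => h1 k.1, if_neg h4]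

theorem sameCycle_rot (h : M.IsFoldFace m n p r) : (rot M m n p r).SameCycle p r := by
  have s := setoid_apply_self (rot M m n p r)
  by_cases hd : M.rot m = n
  · have := s p
    rwa [h.rot_apply_p hd] at this
  · have := SameCycle.trans (s p) (s _)
    rwa [h.rot_apply_p' hd, h.rot_apply_rot hd] at this

theorem proj_m : proj M m n p r m = p := by simp [proj]

theorem proj_rev_m : proj M m n p r (M.rev m) = M.rev p := by
  have := M.rev_ne m
  grind [proj]

theorem proj_n (h : M.IsFoldFace m n p r) : proj M m n p r n = r := by
  have := h.start_n; have := h.m_ne_n; have := h.ne_ma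
  grind [proj]

theorem proj_rev_n (h : M.IsFoldFace m n p r) : proj M m n p r (M.rev n) = M.rev r := by
  have := h.start_n; have := h.ne_ab; have := h.ne_mb
  grind [proj]

theorem proj_of_notMem {z : D} (hz : z ∉ [m, M.rev m, n, M.rev n]) : proj M m n p r z = z := by
  simp only [List.mem_cons, List.not_mem_nil, or_false] at hz
  grind [proj]

theorem sameCycle_proj (h : M.IsFoldFace m n p r) (d : D) :
    (rot M m n p r).SameCycle (proj M m n p r d) (proj M m n p r (M.rot d)) := by
  have hpr := h.sameCycle_rot
  have s := setoid_apply_self (rot M m n p r)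
  have s1 := h.start_n; have s2 := h.start_r
  have s3 := h.start_rev_p; have s4 := h.start_rev_r
  have s5 := M.start_rot m; have s6 := M.start_rot (M.rev n)
  have s7 := h.rev_m_ne_rev_p; have s8 := h.rev_n_ne_rev_r
  have s9 := h.m_ne_n; have s10 := h.p_ne_r
  have mem : ∀ z, z ∈ [m, M.rev m, n, M.rev n] ↔ z = m ∨ z = M.rev m ∨ z = n ∨ z = M.rev n := by
    simp
  by_cases z1 : d = m
  · rw [z1, proj_m]
    by_cases hd : M.rot m = n
    · rwa [hd, h.proj_n]
    · have : M.rot m ∉ [m, M.rev m, n, M.rev n] := by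
        have i4 : M.rot m = M.rot n → m = n := fun k => M.rot.injective k
        have := h.ne_ma; have := h.ne_mb; have := h.rot_n
        rw [mem]
        grind
      rw [proj_of_notMem this, ← h.rot_apply_p' hd]
      exact s p
  by_cases z2 : d = M.rev m
  · have : M.rev p ∉ [m, M.rev m, n, M.rev n] := by
      have := h.ne_ma; have := h.ne_ab
      rw [mem]
      grind
    rw [z2, h.rot_rev_m, proj_rev_m, proj_of_notMem this]
  by_cases z3 : d = n
  · rw [z3, h.rot_n, h.proj_n, proj_m]
    exact hpr.symm
  by_cases z4 : d = M.rev n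
  · have : M.rot (M.rev n) ∉ [m, M.rev m, n, M.rev n] := by
      have i3 : M.rot (M.rev n) = M.rot (M.rev r) → M.rev n = M.rev r := fun k => M.rot.injective k
      have := h.ne_mb; have := h.ne_ab; have := h.rot_rev_r
      rw [mem]
      grind
    rw [z4, h.proj_rev_n, proj_of_notMem this, ← h.rot_apply_rev_r]
    exact s _
  have hd : d ∉ [m, M.rev m, n, M.rev n] := by rw [mem]; tauto
  rw [proj_of_notMem hd]
  by_cases z5 : d = p
  · have : r ∉ [m, M.rev m, n, M.rev n] := by
      have := h.ne_mp; have := h.ne_pa; have := h.ne_pb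
      rw [mem]
      grind
    rwa [z5, h.rot_p, proj_of_notMem this]
  by_cases z6 : M.rot d = n
  · have hz := h.rot_apply d
    rw [z6, h.proj_n]
    have : rot M m n p r d = r := by
      have := h.ne_mb; have := M.start_rot d; have := h.ne_ma
      rw [mem] at hd
      grind
    have k := s d
    rwa [this] at k
  by_cases z7 : M.rot d = M.rev m
  · rw [z7, proj_rev_m, ← h.rot_apply_of_rot_eq_rev_m z7]
    exact s d
  by_cases z8 : M.rot d = M.rev n
  · rw [z8, h.proj_rev_n, M.rot.injective (z8.trans h.rot_rev_r.symm)]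
  have z9 : d ≠ M.rev r := fun k => z8 (k ▸ h.rot_rev_r)
  have z10 : M.rot d ≠ m := fun k => z3 (M.rot.injective (k.trans h.rot_n.symm))
  have : M.rot d ∉ [m, M.rev m, n, M.rev n] := by rw [mem]; tauto
  rw [proj_of_notMem this, ← h.rot_apply_of_ne hd z5 z9 z7 z6]
  exact s d

theorem nodup (h : M.IsFoldFace m n p r) : [m, M.rev m, n, M.rev n].Nodup := by
  have := h.start_n; have := h.m_ne_n; have := h.ne_ma; have := h.ne_mb; have := h.ne_ab
  simp only [List.nodup_cons, List.mem_cons, List.not_mem_nil, or_false, not_or, List.nodup_nil,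
    and_true, not_false_eq_true]
  grind

variable [Finite D]

/-- Merging two opposite vertices of a face. -/
noncomputable def contraction (h : M.IsFoldFace m n p r) : M.Contraction where
  w := M.start m
  x := M.start p
  keep := {z | z ∉ [m, M.rev m, n, M.rev n]}
  rot := rot M m n p r
  proj := proj M m n p r
  ne := h.ne_mp.symm
  rev_mem d := by
    have inv := M.rev_rev
    simp only [List.mem_cons, List.not_mem_nil, or_false, Set.mem_ofPred_eq]
    grind
  rot_mem d := by
    refine apply_mem_iff fun z hz => ?_
    have := h.start_n; have := h.start_r; have := h.start_rev_p; have := h.start_rev_r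
    have := M.start_rot z; have := M.start_rot m; have := M.start_rot (M.rev n)
    have := h.rev_m_ne_rev_p; have := h.rev_n_ne_rev_r; have := h.m_ne_n; have := h.p_ne_r
    have i1 : M.rot z = M.rot n → z = n := fun k => M.rot.injective k
    have i2 : M.rot z = M.rot (M.rev r) → z = M.rev r := fun k => M.rot.injective k
    have i3 : M.rot (M.rev n) = M.rot (M.rev r) → M.rev n = M.rev r := fun k => M.rot.injective k
    have i4 : M.rot m = M.rot n → m = n := fun k => M.rot.injective k
    simp only [List.mem_cons, List.not_mem_nil, or_false, Set.mem_ofPred_eq, h.rot_apply] at hz ⊢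
    obtain ⟨h1, h2, h3, h4, h5, h6, h7, h8, h9, h10, h11⟩ := h
    grind
  proj_mem d := by
    have := h.start_r; have := h.start_rev_p; have := h.start_rev_r; have := h.start_n
    have := h.rev_m_ne_rev_p; have := h.rev_n_ne_rev_r; have := h.m_ne_n; have := h.p_ne_r
    obtain ⟨h1, h2, h3, h4, h5, h6, h7, h8, h9, h10, h11⟩ := h
    simp only [List.mem_cons, List.not_mem_nil, or_false, Set.mem_ofPred_eq, proj]
    grind
  proj_of_mem d hd := by
    simp only [List.mem_cons, List.not_mem_nil, or_false, Set.mem_ofPred_eq] at hd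
    grind [proj]
  proj_rev d := by
    have inv := M.rev_rev
    have := h.start_r; have := h.start_rev_p; have := h.start_rev_r; have := h.start_n
    have := h.rev_m_ne_rev_p; have := h.rev_n_ne_rev_r; have := h.m_ne_n; have := h.p_ne_r
    obtain ⟨h1, h2, h3, h4, h5, h6, h7, h8, h9, h10, h11⟩ := h
    grind [proj]
  sameCycle_proj := h.sameCycle_proj
  start_proj d := by
    have := h.start_r; have := h.start_rev_p; have := h.start_rev_r; have := h.start_n
    grind [proj]
  start_rot d := by
    have := h.start_n; have := h.start_r; have := h.start_rev_p; have := h.start_rev_r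
    have := M.start_rot d; have := M.start_rot m; have := M.start_rot (M.rev n)
    rw [h.rot_apply]
    grind
  bridge := ⟨m, rfl, by simp [proj]⟩
  conj := rev_mul_rot

end IsFoldFace
end OrientedMap

/-! ### Folding undoes `P₀` and `P₁` -/

namespace OrientedMap

variable {V : Type u} {D : Type v} {M : OrientedMap V D} {m n p r : D} [Finite D]

namespace IsFoldFace

theorem mem_keep (h : M.IsFoldFace m n p r) (d : D) :
    d ∈ h.contraction.keep ↔ d ∉ [m, M.rev m, n, M.rev n] := Iff.rfl

theorem mem_keep_of_start_ne (h : M.IsFoldFace m n p r) {d : D} (h1 : M.start d ≠ M.start m)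
    (h2 : d ≠ M.rev m) (h3 : d ≠ M.rev n) : d ∈ h.contraction.keep := by
  have := h.start_n
  rw [mem_keep]
  simp only [List.mem_cons, List.not_mem_nil, or_false]
  grind

theorem p_mem (h : M.IsFoldFace m n p r) : p ∈ h.contraction.keep :=
  h.mem_keep_of_start_ne h.ne_mp.symm (fun k => h.ne_pa (congrArg M.start k))
    fun k => h.ne_pb (congrArg M.start k)

theorem r_mem (h : M.IsFoldFace m n p r) : r ∈ h.contraction.keep := by
  have := h.start_r
  exact h.mem_keep_of_start_ne (this ▸ h.ne_mp.symm)
    (fun k => h.ne_pa (this ▸ congrArg M.start k)) fun k => h.ne_pb (this ▸ congrArg M.start k)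

theorem eq_of_start_eq (h : M.IsFoldFace m n p r) {d : D} (hd : M.start d = M.start m) :
    d = m ∨ d = n ∨ d = M.rot m := by
  refine (start_eq_iff.1 hd.symm).mem_of_mapsTo (S := {d | d = m ∨ d = n ∨ d = M.rot m}) ?_
    (Or.inl rfl)
  rintro z (rfl | rfl | rfl)
  · exact Or.inr (Or.inr rfl)
  · exact Or.inl h.rot_n
  · rcases h.short with k | k
    · rw [k]; exact Or.inl h.rot_n
    · exact Or.inr (Or.inl k)

/-- Undoing the extension `P₀`. -/
theorem extP0 (h : M.IsFoldFace m n p r) (hd : M.rot m = n) : ExtP0 h.contraction.map M := by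
  have hsr := h.start_r
  have hsp' := h.start_rev_p
  have hsr' := h.start_rev_r
  have hsn := h.start_n
  have st : ∀ {d : {d : D // d ∈ h.contraction.keep}}, M.start d ≠ M.start m →
      (h.contraction.map.start d : V) = M.start d := fun hd =>
    congrArg Subtype.val (h.contraction.map_start_of_ne hd)
  refine ⟨_, _, _, m, n, ⟨p, h.p_mem⟩, ⟨r, h.r_mem⟩,
    h.contraction.addsVertexAndTwoEdges h.mem_keep h.nodup, Subtype.ext (h.rot_apply_p hd), ?_, ?_,
    rfl, ?_, hsn, ?_, hd, h.rot_n, ?_, h.rot_rev_m, h.rot_rev_r, ?_, ?_⟩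
  · have e1 := st (d := ⟨p, h.p_mem⟩) h.ne_mp.symm
    have e2 := st (d := h.contraction.map.rev ⟨p, h.p_mem⟩) (hsp' ▸ h.ne_ma.symm)
    have e3 := st (d := h.contraction.map.rev ⟨r, h.r_mem⟩) (hsr' ▸ h.ne_mb.symm)
    simp only [List.nodup_cons, List.mem_cons, List.not_mem_nil, or_false, not_or, List.nodup_nil,
      and_true, not_false_eq_true, target, Subtype.ext_iff, e1, e2, e3]
    exact ⟨⟨hsp' ▸ h.ne_pa, hsr' ▸ h.ne_pb⟩, hsp' ▸ hsr' ▸ h.ne_ab⟩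
  · intro z
    refine (st fun k => ?_).symm
    have := z.2
    rw [mem_keep] at this
    rcases h.eq_of_start_eq k with k | k | k
    · simp [k] at this
    · simp [k] at this
    · simp [k, hd] at this
  · exact hsp'.symm.trans (st (d := h.contraction.map.rev ⟨p, h.p_mem⟩) (hsp' ▸ h.ne_ma.symm)).symm
  · exact hsr'.symm.trans (st (d := h.contraction.map.rev ⟨r, h.r_mem⟩) (hsr' ▸ h.ne_mb.symm)).symm
  · exact fun z hz => h.rot_eq_rev_p_iff.1 (congrArg Subtype.val hz)
  · exact h.rot_apply_rev_r.symm
  · intro z hz hz'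
    have hz2 := (h.mem_keep z).1 z.2
    have k3 : M.rot z ≠ M.rev m := fun k => hz' (Subtype.ext (h.rot_eq_rev_p_iff.2 k))
    -- The general formula excludes `p`, but for degree 2 nothing is inserted between `p` and `r`.
    by_cases k1 : (z : D) = p
    · have : z = ⟨p, h.p_mem⟩ := Subtype.ext k1
      rw [this]
      exact h.rot_p.trans (h.rot_apply_p hd).symm
    · refine (h.rot_apply_of_ne hz2 k1 (fun k => hz (Subtype.ext k)) k3 fun k => ?_).symm
      rw [M.rot.injective (k.trans hd.symm)] at hz2
      simp at hz2

theorem rot_mem_keep (h : M.IsFoldFace m n p r) (hd : M.rot m ≠ n) :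
    M.rot m ∈ h.contraction.keep := by
  have i4 : M.rot m = M.rot n → m = n := fun k => M.rot.injective k
  have := h.ne_ma; have := h.ne_mb; have := h.rot_n; have := h.m_ne_n; have := M.start_rot m
  rw [mem_keep]
  simp only [List.mem_cons, List.not_mem_nil, or_false]
  grind

/-- Undoing the extension `P₁`. -/
theorem extP1 (h : M.IsFoldFace m n p r) (hd : M.rot m ≠ n)
    (hqa : M.start (M.rev (M.rot m)) ≠ M.start (M.rev m))
    (hqb : M.start (M.rev (M.rot m)) ≠ M.start (M.rev n))
    (hqx : M.start (M.rev (M.rot m)) ≠ M.start p)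
    (hqw : M.start (M.rev (M.rot m)) ≠ M.start m) : ExtP1 h.contraction.map M := by
  have hsr := h.start_r
  have hsp' := h.start_rev_p
  have hsr' := h.start_rev_r
  have hsn := h.start_n
  have hq : M.rot (M.rot m) = n := h.short.resolve_left hd
  have hqm := h.rot_mem_keep hd
  have st : ∀ {d : {d : D // d ∈ h.contraction.keep}}, M.start d ≠ M.start m →
      (h.contraction.map.start d : V) = M.start d := fun hd =>
    congrArg Subtype.val (h.contraction.map_start_of_ne hd)
  refine ⟨_, _, _, m, n, ⟨p, h.p_mem⟩, ⟨M.rot m, hqm⟩, ⟨r, h.r_mem⟩,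
    h.contraction.addsVertexAndTwoEdges h.mem_keep h.nodup, Subtype.ext (h.rot_apply_p' hd),
    Subtype.ext (h.rot_apply_rot hd), ?_, ?_, M.start_rot m,
    rfl, ?_, hsn, ?_, rfl, hq, h.rot_n, h.rot_p, ?_, h.rot_rev_m, h.rot_rev_r, ?_, ?_⟩
  · have e1 := st (d := ⟨p, h.p_mem⟩) h.ne_mp.symm
    have e2 := st (d := h.contraction.map.rev ⟨p, h.p_mem⟩) (hsp' ▸ h.ne_ma.symm)
    have e3 := st (d := h.contraction.map.rev ⟨r, h.r_mem⟩) (hsr' ▸ h.ne_mb.symm)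
    have e4 := st (d := h.contraction.map.rev ⟨M.rot m, hqm⟩) hqw
    simp only [List.nodup_cons, List.mem_cons, List.not_mem_nil, or_false, not_or, List.nodup_nil,
      and_true, not_false_eq_true, target, Subtype.ext_iff, e1, e2, e3, e4]
    exact ⟨⟨hsp' ▸ h.ne_pa, hqx.symm, hsr' ▸ h.ne_pb⟩, ⟨hsp' ▸ hqa.symm, hsp' ▸ hsr' ▸ h.ne_ab⟩,
      hsr' ▸ hqb⟩
  · intro z hz
    refine (st fun k => ?_).symm
    have := z.2
    rw [mem_keep] at this
    rcases h.eq_of_start_eq k with k | k | k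
    · simp [k] at this
    · simp [k] at this
    · exact hz (Subtype.ext k)
  · exact hsp'.symm.trans (st (d := h.contraction.map.rev ⟨p, h.p_mem⟩) (hsp' ▸ h.ne_ma.symm)).symm
  · exact hsr'.symm.trans (st (d := h.contraction.map.rev ⟨r, h.r_mem⟩) (hsr' ▸ h.ne_mb.symm)).symm
  · exact fun z hz => h.rot_eq_rev_p_iff.1 (congrArg Subtype.val hz)
  · exact h.rot_apply_rev_r.symm
  · intro z hzp hzq hz hz'
    have k3 : M.rot z ≠ M.rev m := fun k => hz' (Subtype.ext (h.rot_eq_rev_p_iff.2 k))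
    refine (h.rot_apply_of_ne ((h.mem_keep z).1 z.2) (fun k => hzp (Subtype.ext k))
      (fun k => hz (Subtype.ext k)) k3 fun k => ?_).symm
    exact hzq (Subtype.ext (M.rot.injective (k.trans hq.symm)))

end IsFoldFace

end OrientedMap

/-! ### Vertices of degree 1: undoing `D₁` -/

namespace OrientedMap

variable {V : Type u} {D : Type v} {M : OrientedMap V D} {m p r : D}

/-- The directed edge `m` starts in a vertex of degree 1, whose face consists of `m`, `rev m`, `p`
and `rev r`, where the edges of `p` and `r` are distinct. -/
structure IsLeafFace (M : OrientedMap V D) (m p r : D) : Prop where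
  rot_m : M.rot m = m
  rot_rev_m : M.rot (M.rev m) = M.rev p
  rot_p : M.rot p = r
  rot_rev_r : M.rot (M.rev r) = M.rev m
  ne_pr : p ≠ r
  ne_mp : M.start m ≠ M.start p
  ne_ma : M.start m ≠ M.start (M.rev m)
  ne_pa : M.start p ≠ M.start (M.rev m)

namespace IsLeafFace

theorem start_r (h : M.IsLeafFace m p r) : M.start r = M.start p := by
  rw [← h.rot_p, M.start_rot]

theorem start_rev_p (h : M.IsLeafFace m p r) : M.start (M.rev p) = M.start (M.rev m) := by
  rw [← h.rot_rev_m, M.start_rot]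

theorem start_rev_r (h : M.IsLeafFace m p r) : M.start (M.rev r) = M.start (M.rev m) := by
  rw [← h.rot_rev_r, M.start_rot]

theorem rev_p_ne_rev_r (h : M.IsLeafFace m p r) : M.rev p ≠ M.rev r :=
  fun k => h.ne_pr (M.rev.injective k)

theorem rev_m_ne_rev_p (h : M.IsLeafFace m p r) : M.rev m ≠ M.rev p :=
  fun k => h.ne_mp (congrArg M.start (M.rev.injective k))

theorem rev_m_ne_rev_r (h : M.IsLeafFace m p r) : M.rev m ≠ M.rev r :=
  fun k => h.ne_mp ((congrArg M.start (M.rev.injective k)).trans h.start_r)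

open Classical in
/-- The rotation after removing the edge of `m` and identifying the edges of `p` and `r`. -/
noncomputable def rot (M : OrientedMap V D) (p r : D) : Perm D :=
  swap p r * M.rot * swap (M.rev p) (M.rev r)

/-- The identification of the edges of `m` and `p` with the edge of `r`. -/
noncomputable def proj (M : OrientedMap V D) (m p r z : D) : D :=
  open Classical in
  if z = m then r else if z = M.rev m then M.rev r else if z = p then r
    else if z = M.rev p then M.rev r else z

/-- Again the face `m, rev m, p, rev r` is carried onto the discarded directed edges `m, rev m, p,
rev p`. -/
theorem rev_mul_rot : ∃ ψ : Perm D, M.rev * rot M p r = ψ * M.facePerm * ψ⁻¹ := by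
  classical
  refine ⟨swap (M.rev p) (M.rev r), ?_⟩
  rw [swap_inv, facePerm, rot, mul_assoc, ← mul_assoc M.rev, mul_swap_eq_swap_mul]
  simp only [mul_assoc]

theorem rot_apply_rev_r (h : M.IsLeafFace m p r) : rot M p r (M.rev r) = M.rot (M.rev p) := by
  classical
  have := M.start_rot (M.rev p); have := h.start_rev_p; have := h.ne_pa; have := h.start_r
  rw [rot, mul_apply, swap_apply_right, mul_apply, swap_apply_of_ne_of_ne] <;> grind

theorem rot_apply_of_rot_eq_p (h : M.IsLeafFace m p r) {z : D} (hz : M.rot z = p) :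
    rot M p r z = r := by
  classical
  have := M.start_rot z; have := h.start_rev_p; have := h.ne_pa; have := h.start_rev_r
  rw [rot, mul_apply, swap_apply_of_ne_of_ne, mul_apply, hz, swap_apply_left] <;> grind

theorem rot_apply_of_ne (h : M.IsLeafFace m p r) {z : D} (h1 : z ≠ p) (h2 : z ≠ M.rev p)
    (h3 : z ≠ M.rev r) (h4 : M.rot z ≠ p) : rot M p r z = M.rot z := by
  classical
  rw [rot, mul_apply, swap_apply_of_ne_of_ne h2 h3, mul_apply, swap_apply_of_ne_of_ne h4]
  exact fun k => h1 (M.rot.injective (k.trans h.rot_p.symm))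

theorem rot_eq_r_iff (h : M.IsLeafFace m p r) {z : D} : rot M p r z = r ↔ M.rot z = p := by
  refine ⟨fun hz => ?_, h.rot_apply_of_rot_eq_p⟩
  have e := h.rot_apply_of_rot_eq_p (z := M.rot.symm p) (apply_symm_apply _ _)
  rw [(rot M p r).injective (hz.trans e.symm), apply_symm_apply]

theorem proj_m : proj M m p r m = r := by simp [proj]

theorem proj_rev_m : proj M m p r (M.rev m) = M.rev r := by
  have := M.rev_ne m
  grind [proj]

theorem proj_p (h : M.IsLeafFace m p r) : proj M m p r p = r := by
  have := h.ne_pa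
  grind [proj]

theorem proj_rev_p (h : M.IsLeafFace m p r) : proj M m p r (M.rev p) = M.rev r := by
  have := h.start_rev_p; have := h.ne_pa; have := h.ne_ma
  grind [proj]

theorem proj_of_notMem {z : D} (hz : z ∉ [m, M.rev m, p, M.rev p]) : proj M m p r z = z := by
  simp only [List.mem_cons, List.not_mem_nil, or_false] at hz
  grind [proj]

theorem r_notMem (h : M.IsLeafFace m p r) : r ∉ [m, M.rev m, p, M.rev p] := by
  have := h.start_rev_p; have := h.ne_pa; have := h.ne_mp; have := h.start_r; have := h.ne_pr
  simp only [List.mem_cons, List.not_mem_nil, or_false]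
  grind

theorem rev_r_notMem (h : M.IsLeafFace m p r) : M.rev r ∉ [m, M.rev m, p, M.rev p] := by
  have := h.start_rev_r; have := h.ne_pa; have := h.ne_ma
  have := h.rev_m_ne_rev_r; have := h.rev_p_ne_rev_r
  simp only [List.mem_cons, List.not_mem_nil, or_false]
  grind

theorem rot_rev_p_notMem (h : M.IsLeafFace m p r) :
    M.rot (M.rev p) ∉ [m, M.rev m, p, M.rev p] := by
  have i1 : M.rot (M.rev p) = M.rot (M.rev m) → M.rev p = M.rev m := fun k => M.rot.injective k
  have i2 : M.rot (M.rev p) = M.rot (M.rev r) → M.rev p = M.rev r := fun k => M.rot.injective k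
  have := M.start_rot (M.rev p); have := h.start_rev_p; have := h.ne_pa; have := h.ne_ma
  have := h.rev_m_ne_rev_p; have := h.rev_p_ne_rev_r; have := h.rot_rev_m; have := h.rot_rev_r
  simp only [List.mem_cons, List.not_mem_nil, or_false]
  grind

theorem rot_notMem (h : M.IsLeafFace m p r) {d : D} (hd : d ∉ [m, M.rev m, p, M.rev p])
    (h1 : d ≠ M.rev r) (h2 : M.rot d ≠ p) : M.rot d ∉ [m, M.rev m, p, M.rev p] := by
  have i1 : M.rot d = M.rot m → d = m := fun k => M.rot.injective k
  have i2 : M.rot d = M.rot (M.rev m) → d = M.rev m := fun k => M.rot.injective k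
  have i3 : M.rot d = M.rot (M.rev r) → d = M.rev r := fun k => M.rot.injective k
  have := h.rot_m; have := h.rot_rev_m; have := h.rot_rev_r
  simp only [List.mem_cons, List.not_mem_nil, or_false] at hd ⊢
  grind

theorem rot_mem (h : M.IsLeafFace m p r) {d : D} (hd : d ∉ [m, M.rev m, p, M.rev p]) :
    rot M p r d ∉ [m, M.rev m, p, M.rev p] := by
  by_cases h1 : d = M.rev r
  · rw [h1, h.rot_apply_rev_r]; exact h.rot_rev_p_notMem
  by_cases h2 : M.rot d = p
  · rw [h.rot_apply_of_rot_eq_p h2]; exact h.r_notMem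
  have hd' := h.rot_notMem hd h1 h2
  simp only [List.mem_cons, List.not_mem_nil, or_false, not_or] at hd
  rwa [h.rot_apply_of_ne hd.2.2.1 hd.2.2.2 h1 h2]

theorem sameCycle_proj [Finite D] (h : M.IsLeafFace m p r) (d : D) :
    (rot M p r).SameCycle (proj M m p r d) (proj M m p r (M.rot d)) := by
  have s := setoid_apply_self (rot M p r)
  by_cases z1 : d = m
  · rw [z1, h.rot_m]
  by_cases z2 : d = M.rev m
  · rw [z2, h.rot_rev_m, proj_rev_m, h.proj_rev_p]
  by_cases z3 : d = p
  · rw [z3, h.rot_p, h.proj_p, proj_of_notMem h.r_notMem]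
  by_cases z4 : d = M.rev p
  · rw [z4, h.proj_rev_p, proj_of_notMem h.rot_rev_p_notMem, ← h.rot_apply_rev_r]
    exact s _
  have hd : d ∉ [m, M.rev m, p, M.rev p] := by
    simp only [List.mem_cons, List.not_mem_nil, or_false]
    tauto
  by_cases z5 : d = M.rev r
  · rw [z5, h.rot_rev_r, proj_of_notMem h.rev_r_notMem, proj_rev_m]
  rw [proj_of_notMem hd]
  have k := s d
  by_cases z6 : M.rot d = p
  · rw [h.rot_apply_of_rot_eq_p z6] at k
    rwa [z6, h.proj_p]
  · rw [h.rot_apply_of_ne z3 z4 z5 z6] at k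
    rwa [proj_of_notMem (h.rot_notMem hd z5 z6)]

theorem nodup (h : M.IsLeafFace m p r) : [m, M.rev m, p, M.rev p].Nodup := by
  have := h.start_rev_p; have := h.ne_pa; have := h.ne_ma; have := h.ne_mp
  have := h.rev_m_ne_rev_p
  simp only [List.nodup_cons, List.mem_cons, List.not_mem_nil, or_false, not_or, List.nodup_nil,
    and_true, not_false_eq_true]
  grind

theorem start_rot (h : M.IsLeafFace m p r) (d : D) : M.start (rot M p r d) = M.start d := by
  classical
  have key : ∀ {a b : D}, M.start a = M.start b → ∀ z, M.start (swap a b z) = M.start z := by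
    intro a b hab z
    rw [swap_apply_def]
    split_ifs with h1 h2
    · rw [h1, hab]
    · rw [h2, hab]
    · rfl
  rw [rot, mul_apply, mul_apply, key h.start_r.symm, M.start_rot,
    key (h.start_rev_p.trans h.start_rev_r.symm)]

variable [Finite D]

/-- Removing a vertex of degree 1, and identifying two parallel edges. -/
noncomputable def contraction (h : M.IsLeafFace m p r) : M.Contraction where
  w := M.start m
  x := M.start p
  keep := {z | z ∉ [m, M.rev m, p, M.rev p]}
  rot := rot M p r
  proj := proj M m p r
  ne := h.ne_mp.symm
  rev_mem d := by
    have inv := M.rev_rev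
    simp only [List.mem_cons, List.not_mem_nil, or_false, Set.mem_ofPred_eq]
    grind
  rot_mem d := apply_mem_iff fun z hz => h.rot_mem hz
  proj_mem d := by
    have h1 := h.r_notMem
    have h2 := h.rev_r_notMem
    simp only [List.mem_cons, List.not_mem_nil, or_false, Set.mem_ofPred_eq, proj] at h1 h2 ⊢
    grind
  proj_of_mem d hd := proj_of_notMem hd
  proj_rev d := by
    have inv := M.rev_rev
    have n := h.nodup
    simp only [List.nodup_cons, List.mem_cons, List.not_mem_nil, or_false, not_or, List.nodup_nil,
      and_true, not_false_eq_true] at n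
    grind [proj]
  sameCycle_proj := h.sameCycle_proj
  start_proj d := by
    have := h.start_r; have := h.start_rev_p; have := h.start_rev_r
    grind [proj]
  start_rot d := Or.inl (h.start_rot d)
  bridge := ⟨m, rfl, by rw [proj_m, h.start_r]⟩
  conj := rev_mul_rot

theorem mem_keep (h : M.IsLeafFace m p r) (d : D) :
    d ∈ h.contraction.keep ↔ d ∉ [m, M.rev m, p, M.rev p] := Iff.rfl

/-- Undoing the extension `D₁`. -/
theorem extD1 (h : M.IsLeafFace m p r) : ExtD1 h.contraction.map M := by
  have hsr := h.start_r
  have hsp' := h.start_rev_p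
  have hsr' := h.start_rev_r
  have st : ∀ {d : {d : D // d ∈ h.contraction.keep}}, M.start d ≠ M.start m →
      (h.contraction.map.start d : V) = M.start d := fun hd =>
    congrArg Subtype.val (h.contraction.map_start_of_ne hd)
  -- In `ExtD1` the new directed edges start at the neighbour of the leaf, so they are `rev m` and
  -- `rev p`, and the doubled edge is `rev r`.
  have hk : ∀ d, d ∈ h.contraction.keep ↔ d ∉ [M.rev m, M.rev (M.rev m), M.rev p, M.rev (M.rev p)] := by
    intro d
    rw [mem_keep, M.rev_rev, M.rev_rev]
    simp only [List.mem_cons, List.not_mem_nil, or_false]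
    tauto
  have hn : [M.rev m, M.rev (M.rev m), M.rev p, M.rev (M.rev p)].Nodup := by
    have := h.nodup
    rw [M.rev_rev, M.rev_rev]
    simp only [List.nodup_cons, List.mem_cons, List.not_mem_nil, or_false, not_or, List.nodup_nil,
      and_true, not_false_eq_true] at this ⊢
    grind
  have e1 := st (d := ⟨M.rev r, h.rev_r_notMem⟩) (hsr' ▸ h.ne_ma.symm)
  have e2 := st (d := ⟨r, h.r_notMem⟩) (hsr ▸ h.ne_mp.symm)
  have e3 : h.contraction.map.rev ⟨M.rev r, h.rev_r_notMem⟩ = ⟨r, h.r_notMem⟩ :=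
    Subtype.ext (M.rev_rev r)
  refine ⟨_, _, _, M.rev m, M.rev p, ⟨M.rev r, h.rev_r_notMem⟩,
    h.contraction.addsVertexAndTwoEdges hk hn, ?_, ?_, ?_, ?_, ?_, ?_, ?_, h.rot_rev_r,
    h.rot_rev_m, h.rot_apply_rev_r.symm, ?_, ?_, ?_⟩
  · rw [target, e3, Ne, Subtype.ext_iff, e1, e2]
    exact fun k => h.ne_pa (by rw [← hsr, ← k, hsr'])
  · intro z
    refine (st fun k => ?_).symm
    have := (start_eq_iff.1 k.symm).mem_of_mapsTo (S := {m})
      (fun z hz => by rw [hz, h.rot_m]; rfl) rfl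
    have hz := z.2
    rw [mem_keep, this] at hz
    simp at hz
  · exact hsr'.symm.trans e1.symm
  · rw [target, M.rev_rev]; rfl
  · exact (hsp'.trans hsr'.symm).trans e1.symm
  · rw [target, M.rev_rev, target, e3]
    exact hsr.symm.trans e2.symm
  · rw [M.rev_rev, h.rot_m]
  · intro z hz
    rw [e3] at hz
    rw [M.rev_rev]
    exact h.rot_eq_r_iff.1 (congrArg Subtype.val hz)
  · rw [M.rev_rev, e3]
    exact h.rot_p
  · intro z hz hz'
    rw [e3] at hz'
    have hz2 := (h.mem_keep z).1 z.2
    simp only [List.mem_cons, List.not_mem_nil, or_false, not_or] at hz2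
    exact (h.rot_apply_of_ne hz2.2.2.1 hz2.2.2.2 (fun k => hz (Subtype.ext k))
      fun k => hz' (Subtype.ext (h.rot_eq_r_iff.2 k))).symm

end IsLeafFace

/-! ### The reduction step and the induction -/

theorem IsQuadrangulation.isPath3_or_isLeafFace [Finite D] (h : M.IsQuadrangulation)
    (hp : M.IsPlane) (hm : M.rot m = m) : M.IsPath3 ∨ ∃ p r, M.IsLeafFace m p r := by
  have hl := h.start_ne_target hp
  obtain ⟨h4, h2⟩ := isQuadrangulation_iff.1 h m
  simp only [facePerm, mul_apply, hm] at h4 h2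
  generalize hpd : M.rev (M.rot (M.rev m)) = p at h4 h2
  have e1 : M.rot (M.rev m) = M.rev p := by rw [← hpd, M.rev_rev]
  have e2 : M.rot (M.rev (M.rot p)) = M.rev m := by
    have := congrArg M.rev h4
    rwa [M.rev_rev] at this
  have hsp : M.start (M.rev p) = M.start (M.rev m) := by rw [← e1, M.start_rot]
  -- If the two edges bounding the leaf's face coincide, the vertex opposite the leaf is itself a
  -- leaf.
  by_cases hpr : p = M.rot p
  · left
    rw [← hpr] at e2
    exact isPath3_of_rot hl (fun k => h2 (M.rev.injective k).symm) e1 e2 (by rw [M.rev_rev, hm])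
      (by rw [M.rev_rev, ← hpr])
  · right
    refine ⟨p, M.rot p, hm, e1, rfl, e2, hpr, fun k => h2 ?_, hl m, fun k => hl p (k.trans hsp.symm)⟩
    exact (start_eq_iff.1 k).mem_of_mapsTo (S := {m}) (fun z hz => by rw [hz, hm]; rfl) rfl

theorem IsQuadrangulation.isPath3_or_isFoldFace [Finite D] (h : M.IsQuadrangulation)
    (hp : M.IsPlane) {n : D} (hm : M.rot m ≠ m) (hn : M.rot n = m)
    (hs : M.rot m = n ∨ M.rot (M.rot m) = n)
    (hsimple : ∀ d e, M.start d = M.start m → M.start e = M.start m →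
      M.start (M.rev d) = M.start (M.rev e) → d = e) :
    M.IsPath3 ∨ ∃ p r, M.IsFoldFace m n p r := by
  have hl := h.start_ne_target hp
  obtain ⟨h4, h2⟩ := isQuadrangulation_iff.1 h n
  simp only [facePerm, mul_apply, hn] at h4 h2
  generalize hpd : M.rev (M.rot (M.rev m)) = p at h4 h2
  have e1 : M.rot (M.rev m) = M.rev p := by rw [← hpd, M.rev_rev]
  have e2 : M.rot (M.rev (M.rot p)) = M.rev n := by
    have := congrArg M.rev h4
    rwa [M.rev_rev] at this
  have hsp : M.start (M.rev p) = M.start (M.rev m) := by rw [← e1, M.start_rot]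
  have hsr : M.start (M.rev (M.rot p)) = M.start (M.rev n) := by rw [← e2, M.start_rot]
  have hsn : M.start n = M.start m := by rw [← hn, M.start_rot]
  have hmn : m ≠ n := fun k => hm (by conv_lhs => rw [k, hn])
  -- If the face meets `w` in two opposite corners, then, as no edges at `w` are parallel, its four
  -- sides are only two edges, each used in both directions.
  by_cases hpm : M.start p = M.start m
  · left
    have hpm' : p = m := hsimple p m hpm rfl hsp
    rw [hpm'] at e1 e2 hsr
    have hr : M.rot m = n := hsimple _ _ (M.start_rot m) hsn hsr
    rw [hr] at e2
    exact isPath3_of_rot hl hmn hr hn e1 e2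
  · right
    refine ⟨p, M.rot p, hn, e1, rfl, e2, hs, Ne.symm hpm, hl m, hsn ▸ hl n,
      fun k => hl p (k.trans hsp.symm), fun k => hl (M.rot p) ?_, fun k => hmn (hsimple m n rfl hsn k)⟩
    rw [M.start_rot, k, hsr]

theorem generated_of_isPlane_of_isQuadrangulation [Finite D] (hp : M.IsPlane)
    (h : M.IsQuadrangulation) : M.Generated := by
  induction hc : Nat.card D using Nat.strong_induction_on generalizing V D with
  | _ k ih =>
    obtain ⟨m, hm, hsimple⟩ := h.exists_reducible hp
    by_cases h1 : M.rot m = m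
    · rcases h.isPath3_or_isLeafFace hp h1 with hP | ⟨p, r, hF⟩
      · exact .base M hP
      · have hk := hF.contraction.card_keep hF.mem_keep hF.nodup
        exact .extD1 _ M (ih _ (by omega) (hF.contraction.isPlane_map h hp hk)
          (hF.contraction.isQuadrangulation_map h) rfl) hF.extD1
    obtain ⟨n, hn, hs⟩ : ∃ n, M.rot n = m ∧ (M.rot m = n ∨ M.rot (M.rot m) = n) := by
      rcases hm with hm | hm | hm
      · exact absurd hm h1
      · exact ⟨_, hm, Or.inl rfl⟩
      · exact ⟨_, hm, Or.inr rfl⟩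
    rcases h.isPath3_or_isFoldFace hp h1 hn hs hsimple with hP | ⟨p, r, hF⟩
    · exact .base M hP
    have hk := hF.contraction.card_keep hF.mem_keep hF.nodup
    have hplane := hF.contraction.isPlane_map h hp hk
    have hquad := hF.contraction.isQuadrangulation_map h
    have hgen := ih _ (by omega) hplane hquad rfl
    by_cases h2 : M.rot m = n
    · exact .extP0 _ M hgen (hF.extP0 h2)
    · have hl := h.start_ne_target hp
      have hsq := M.start_rot m
      have hsn := hF.start_n
      have hqw : M.start (M.rev (M.rot m)) ≠ M.start m := fun e => hl (M.rot m) (hsq.trans e.symm)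
      refine .extP1 _ M hgen (hF.extP1 h2 (fun e => h1 (hsimple _ _ hsq rfl e))
        (fun e => h2 (hsimple _ _ hsq hsn e)) (fun e => ?_) hqw)
      -- If the third neighbour of `w` were `x`, folding would create a loop in a plane
      -- quadrangulation.
      have hqm := hF.rot_mem_keep h2
      apply hquad.start_ne_target hplane ⟨M.rot m, hqm⟩
      rw [hF.contraction.map_start_of_eq (d := ⟨M.rot m, hqm⟩) hsq,
        hF.contraction.map_start_of_ne (d := hF.contraction.map.rev ⟨M.rot m, hqm⟩) hqw]
      exact Subtype.ext e.symm

end OrientedMap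

theorem mainTheorem4 {V : Type u} {D : Type v} [Finite V] [Finite D] (M : OrientedMap V D)
    (hplane : M.IsPlane) (hquad : M.IsQuadrangulation) : M.Generated :=
  OrientedMap.generated_of_isPlane_of_isQuadrangulation hplane hquad
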